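/- **Theorem.** Let $b\ge 1$ be an integer (the bucket size) and $0<\alpha<1$. *Infinite Poisson model.* Let $(X_i)_{i\in\mathbb Z}$ be i.i.d. random variables with $X_i\sim\mathrm{Po}(\alpha b)$, and define the overflow and the profile by $$Q_{\alpha;i}=\max_{j\le i}\sum_{k=j+1}^{i}(X_k-b),\qquad H_{\alpha;i}=X_i+Q_{\alpha;i-1}\qquad(i\in\mathbb Z).$$ Almost surely these maxima are finite and $(H_{\alpha;i},Q_{\alpha;i})_{i\in\mathbb Z}$ is the smallest solution in non-negative integers of the hashing equations $H_i=X_i+Q_{i-1}$, $Q_i=\max(H_i-b,0)$. *Exact model.* For $m\ge1$, $n\ge0$ let $n$ keys, with independent uniformly distributed hash addresses in $\mathbb Z_m$, be entered one after another into an empty cyclic table of $m$ buckets of capacity $b$; a key with address $a$ tries $a,a+1,a+2,\dots$ (cyclically) and is placed in the first bucket that is not full. Let $H_{m,n;i}$ be the number of keys that try bucket $i$ and $Q_{m,n;i}$ the number of keys that try bucket $i$ without finding room there ($i\in\mathbb Z$ is read modulo $m$). Let $T(z)=\sum_{n\ge1}\frac{n^{n-1}}{n!}z^n$, $\omega=e^{2\pi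 \mathrm i/b}$ and $\zeta_\ell=T(\omega^\ell\alpha e^{-\alpha})/\alpha$, and consider the meromorphic functions on $\mathbb C$ (with removable singularities removed) $$\psi_H(q)=\frac{b(1-\alpha)(q-1)}{q^b e^{\alpha b(1-q)}-1}\cdot\frac{\prod_{\ell=1}^{b-1}(q-\zeta_\ell)}{\prod_{\ell=1}^{b-1}(1-\zeta_\ell)},\qquad \psi_Q(q)=\frac{b(1-\alpha)(q-1)}{q^b-e^{\alpha b(q-1)}}\cdot\frac{\prod_{\ell=1}^{b-1}(q-\zeta_\ell)}{\prod_{\ell=1}^{b-1}(1-\zeta_\ell)}.$$ Then there is $\delta>0$ such that the following hold. 1. For all $i\in\mathbb Z$ and all complex $q$ with $|q|\le1+\delta$, the expectations $\mathbb E\,q^{H_{\alpha;i}}$ and $\mathbb E\,q^{Q_{\alpha;i}}$ converge absolutely, and $$\mathbb E\,q^{H_{\alpha;i}}=\psi_H(q),\qquad \mathbb E\,q^{Q_{\alpha;i}}=\psi_Q(q),\qquad \mathbb E\,q^{H_{\alpha;i}}=e^{\alpha b(q-1)}\,\mathbb E\,q^{Q_{\alpha;i}}.$$ Moreover $H_{\alpha;i}$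 and $Q_{\alpha;i}$ have finite moments of all orders. 2. Whenever $m,n\to\infty$ with $n/(bm)\to\alpha$, for every fixed $i\in\mathbb Z$: $H_{m,n;i}\to H_{\alpha;i}$ and $Q_{m,n;i}\to Q_{\alpha;i}$ in distribution; $\mathbb E\,q^{H_{m,n;i}}\to\psi_H(q)$ and $\mathbb E\,q^{Q_{m,n;i}}\to\psi_Q(q)$ uniformly for $|q|\le1+\delta$; and $\mathbb E H_{m,n;i}^{\ell}\to\mathbb E H_{\alpha;i}^{\ell}$ and $\mathbb E Q_{m,n;i}^{\ell}\to\mathbb E Q_{\alpha;i}^{\ell}$ for every integer $\ell\ge0$. -/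

import Mathlib

open MeasureTheory ProbabilityTheory Filter Topology

noncomputable section

/-! ### The tree function and the numbers `ζ_ℓ` -/

/-- The tree function `T(z) = ∑_{n ≥ 1} n^(n-1) / n! * z^n` (convergent for `‖z‖ ≤ e⁻¹`);
the summation index is shifted by one. -/
def treeFunction (z : ℂ) : ℂ :=
  ∑' n : ℕ, ((n + 1 : ℕ) : ℂ) ^ n / ((n + 1).factorial : ℂ) * z ^ (n + 1)

/-- `ω = exp (2πi / b)`. -/
def rootOmega (b : ℕ) : ℂ := Complex.exp (2 * Real.pi * Complex.I / b)

/-- `ζ_ℓ = T(ω^ℓ α e^{-α}) / α`. -/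
def zetaRoot (b : ℕ) (α : ℝ) (l : ℕ) : ℂ :=
  treeFunction (rootOmega b ^ l * α * Complex.exp (-α)) / α

/-- The explicit quotient for the generating function of the profile. -/
def profileFormula (b : ℕ) (α : ℝ) (q : ℂ) : ℂ :=
  b * (1 - α) * (q - 1) / (q ^ b * Complex.exp (α * b * (1 - q)) - 1) *
    ((∏ l ∈ Finset.Ico 1 b, (q - zetaRoot b α l)) / ∏ l ∈ Finset.Ico 1 b, (1 - zetaRoot b α l))

/-- The explicit quotient for the generating function of the overflow. -/
def overflowFormula (b : ℕ) (α : ℝ) (q : ℂ) : ℂ :=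
  b * (1 - α) * (q - 1) / (q ^ b - Complex.exp (α * b * (q - 1))) *
    ((∏ l ∈ Finset.Ico 1 b, (q - zetaRoot b α l)) / ∏ l ∈ Finset.Ico 1 b, (1 - zetaRoot b α l))

/-- The meromorphic function on `ℂ` given by `profileFormula`: the values of the quotient at its
removable singularities are replaced by the limits there. -/
def psiH (b : ℕ) (α : ℝ) : ℂ → ℂ := toMeromorphicNFOn (profileFormula b α) Set.univ

/-- The meromorphic function on `ℂ` given by `overflowFormula`: the values of the quotient at its
removable singularities are replaced by the limits there. -/
def psiQ (b : ℕ) (α : ℝ) : ℂ → ℂ := toMeromorphicNFOn (overflowFormula b α) Set.univ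

/-- The probability generating function `E q^Z` of an `ℕ`-valued random variable. -/
def pgf {Ω : Type*} [MeasurableSpace Ω] (P : Measure Ω) (Z : Ω → ℕ) (q : ℂ) : ℂ :=
  ∫ ω, q ^ Z ω ∂P

/-! ### Hashing on the cyclic table `ℤ/m` with buckets of size `b` -/

/-- A partially filled table together with its history: `stored i` keys are placed in bucket `i`,
`tried i` keys have tried bucket `i`, and `passed i` keys have tried bucket `i` without finding
room there. -/
structure TableState (m : ℕ) where
  stored : ZMod m → ℕ
  tried : ZMod m → ℕ
  passed : ZMod m → ℕ

/-- The empty table. -/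
def TableState.empty (m : ℕ) : TableState m := ⟨fun _ => 0, fun _ => 0, fun _ => 0⟩

/-- Linear probing: a key with hash address `a` tries `a, a + 1, a + 2, …` in cyclic order and is
placed in the first bucket that is not full, which is `a + d`. -/
def TableState.insert {m : ℕ} (b : ℕ) (s : TableState m) (a : ZMod m) : TableState m :=
  let d : ℕ := sInf {d : ℕ | s.stored (a + d) < b}
  { stored := Function.update s.stored (a + d) (s.stored (a + d) + 1)
    tried := fun i => s.tried i + if ∃ e : ℕ, e ≤ d ∧ i = a + e then 1 else 0
    passed := fun i => s.passed i + if ∃ e : ℕ, e < d ∧ i = a + e then 1 else 0 }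

/-- The table after the keys `0, 1, …, n - 1`, with hash addresses `h`, have been entered. -/
def finalTable (b : ℕ) {m n : ℕ} (h : Fin n → ZMod m) : TableState m :=
  (List.ofFn h).foldl (TableState.insert b) (TableState.empty m)

/-- `H_{m,n;i}`: the number of keys that try bucket `i`; the index `i` is read modulo `m`. -/
def profileMN (b m n : ℕ) (i : ℤ) (h : Fin n → ZMod m) : ℕ := (finalTable b h).tried i

/-- `Q_{m,n;i}`: the overflow from bucket `i`; the index `i` is read modulo `m`. -/
def overflowMN (b m n : ℕ) (i : ℤ) (h : Fin n → ZMod m) : ℕ := (finalTable b h).passed i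

/-- The exact model: the `n` hash addresses are independent and uniform on `ℤ/m`, i.e. the
address vector is uniform on all `m ^ n` possibilities. -/
def exactModel (m n : ℕ) [NeZero m] : Measure (Fin n → ZMod m) :=
  (PMF.uniformOfFintype (Fin n → ZMod m)).toMeasure

instance (m n : ℕ) [NeZero m] : IsProbabilityMeasure (exactModel m n) :=
  PMF.toMeasure.isProbabilityMeasure _

/-! ### Hashing on `ℤ` -/

/-- The hashing equations `H_i = X_i + Q_{i-1}` and `Q_i = (H_i - b)_+` on `ℤ`
(subtraction in `ℕ` is truncated). -/
def HashingEquations (b : ℕ) (X H Q : ℤ → ℕ) : Prop :=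
  ∀ i, H i = X i + Q (i - 1) ∧ Q i = H i - b

/-- `(H, Q)` is the smallest solution of the hashing equations on `ℤ`. -/
def IsMinimalHashing (b : ℕ) (X H Q : ℤ → ℕ) : Prop :=
  HashingEquations b X H Q ∧
    ∀ H' Q' : ℤ → ℕ, HashingEquations b X H' Q' → ∀ i, H i ≤ H' i ∧ Q i ≤ Q' i

/-- The overflow from bucket `i` in hashing on `ℤ`:
`Q_i = max_{j ≤ i} ∑_{j < k ≤ i} (X_k - b)` (nonnegative, by the term `j = i`). -/
def overflowZ (b : ℕ) (X : ℤ → ℕ) (i : ℤ) : ℕ :=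
  (⨆ j : Set.Iic i, ∑ k ∈ Finset.Ioc (j : ℤ) i, ((X k : ℤ) - b)).toNat

/-- The profile in hashing on `ℤ`: the keys with hash address `i` and those that overflow from
bucket `i - 1`. -/
def profileZ (b : ℕ) (X : ℤ → ℕ) (i : ℤ) : ℕ := X i + overflowZ b X (i - 1)

end

/-! The overflow from a bucket is the maximum of a random walk with steps `X k - b`, read backwards
from that bucket; its mean step is negative because `α < 1`. A cyclic table with `n < b * m` keys
satisfies the same hashing equations once its address counts are extended periodically
(`hashingEquations_finalTable`), and its overflow is again such a maximum (`isGreatest_overflowMN`),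
so one Chernoff estimate serves both models. There are `r > 1` and `ρ < 1` (`exists_rate`) for which
the walk `S_l` after `l` steps has `E r^(S_l) ≤ ρ^l`. Summing over `l` and using Markov's inequality
bounds `P(H = j)` by a multiple of `r^(-j)`, eventually uniformly in the table
(`measureReal_mul_pow_le`), and shows that only the last `L` buckets matter, up to an error of order
`ρ^L` (`measureReal_ne_truncOverflow_le`). For fixed `L` the counts in a window converge to
independent Poisson variables (`tendsto_exactModel_window`), so the laws of the profile converge
pointwise. With the common tail bound this passes to integrals of functions growing like `s^j`, `s <
r` (`eventually_norm_integral_sub_le`), which covers convergence in distribution, generating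
functions and moments.

The limit is identified from two relations. Independence and stationarity give `ψ_H = e^(αb(q-1))
ψ_Q`, and `Q = (H - b)_+` makes `q^b ψ_Q - ψ_H` a polynomial of degree at most `b`. Hence `(q^b -
e^(αb(q-1))) ψ_Q` is this polynomial. Since `ψ_Q` is finite on the closed unit disc, it vanishes at
the `b` distinct zeros `ζ_0 = 1, ζ_1, …, ζ_(b-1)` of the first factor there, which determines it up
to a constant, and the derivative at `1` fixes the constant (`overflowFormula_eq_overflowPgf`). That
the `ζ_ℓ` are such zeros rests on `T e^(-T) = z` (`treeFunction_mul_exp`), which is derived from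
Abel's identity. -/

/-! ### Abel's identity -/

/-- The polynomials occurring in Abel's identity. -/
noncomputable def abelPoly (n : ℕ) : Polynomial ℚ :=
  ∑ k ∈ Finset.range n, Polynomial.C ((n.choose (k + 1) : ℚ) * (k + 1) ^ k) *
    (Polynomial.X - Polynomial.C (k + 1 : ℚ)) ^ (n - 1 - k)

/-- The family is of Appell type, so an induction on `n` can recover each polynomial from its
derivative and its value at `0`. -/
lemma derivative_abelPoly (n : ℕ) :
    Polynomial.derivative (abelPoly (n + 1)) = Polynomial.C (n + 1 : ℚ) * abelPoly n := by
  unfold abelPoly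
  rw [Finset.sum_range_succ, Polynomial.derivative_add, Polynomial.derivative_sum, Finset.mul_sum]
  simp only [add_tsub_cancel_right, tsub_self, pow_zero, mul_one, Polynomial.derivative_C, add_zero]
  refine Finset.sum_congr rfl fun k hk => ?_
  have hk' := Finset.mem_range.1 hk
  rw [Polynomial.derivative_C_mul, Polynomial.derivative_X_sub_C_pow]
  have h := Nat.choose_mul_succ_eq n (k + 1)
  have h' : ((n.choose (k + 1) : ℚ)) * (n + 1) = ((n + 1).choose (k + 1)) * ((n - k : ℕ) : ℚ) := by
    have e : n + 1 - (k + 1) = n - k := by omega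
    rw [e] at h
    exact_mod_cast h
  rw [← mul_assoc, ← mul_assoc, ← Polynomial.C_mul, ← Polynomial.C_mul,
    show n - 1 - k = n - k - 1 by omega]
  congr 2
  linear_combination (-(k + 1 : ℚ) ^ k) * h'

/-- The value is the finite difference of order `n + 2` of `x ^ (n + 1)` at `0`, which vanishes
because the order exceeds the degree. -/
lemma eval_zero_abelPoly (n : ℕ) : (abelPoly (n + 2)).eval 0 = 0 := by
  have h := fwdDiff_iter_eq_sum_shift (1 : ℚ) (fun x : ℚ => x ^ (n + 1)) (n + 2) 0
  have h0 := fwdDiff_iter_pow_eq_zero_of_lt (R := ℚ) (j := n + 1) (n := n + 2) (by omega)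
  rw [h0] at h
  rw [Finset.sum_range_succ'] at h
  unfold abelPoly
  rw [Polynomial.eval_finsetSum]
  simp only [Pi.zero_apply, nsmul_eq_mul, mul_one, zero_add, zsmul_eq_mul] at h
  simp only [Nat.cast_zero, ne_eq, Nat.add_eq_zero_iff, one_ne_zero, and_false, not_false_eq_true,
    zero_pow, mul_zero, add_zero] at h
  refine Eq.trans (Finset.sum_congr rfl fun k hk => ?_) h.symm
  have hk' := Finset.mem_range.1 hk
  simp only [Polynomial.eval_mul, Polynomial.eval_C, Polynomial.eval_pow, Polynomial.eval_sub,
    Polynomial.eval_X]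
  rw [show n + 2 - (k + 1) = n + 2 - 1 - k by omega]
  push_cast
  have e : ((k : ℚ) + 1) ^ (n + 1) = (k + 1) ^ k * (k + 1) ^ (n + 1 - k) := by
    rw [← pow_add]
    congr 1
    omega
  rw [e, show (0 : ℚ) - (k + 1) = -(k + 1) by ring, neg_pow ((k : ℚ) + 1)]
  ring

lemma abelPoly_eq (n : ℕ) :
    abelPoly (n + 1) = Polynomial.C (n + 1 : ℚ) * Polynomial.X ^ n := by
  induction n with
  | zero => simp [abelPoly]
  | succ n ih =>
    have hd : Polynomial.derivative (abelPoly (n + 2) -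
        Polynomial.C (n + 2 : ℚ) * Polynomial.X ^ (n + 1)) = 0 := by
      rw [Polynomial.derivative_sub, derivative_abelPoly, ih, Polynomial.derivative_C_mul,
        Polynomial.derivative_X_pow]
      push_cast
      simp only [map_add, map_natCast, map_one, map_ofNat]
      ring
    have hc := Polynomial.eq_C_of_derivative_eq_zero hd
    have h0 : (abelPoly (n + 2) -
        Polynomial.C (n + 2 : ℚ) * Polynomial.X ^ (n + 1)).coeff 0 = 0 := by
      rw [Polynomial.coeff_zero_eq_eval_zero, Polynomial.eval_sub, eval_zero_abelPoly]
      simp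
    rw [h0, map_zero, sub_eq_zero] at hc
    rw [hc]
    push_cast
    congr 2
    ring

/-- Evaluation of `abelPoly_eq` at `n + 2`, where `X - (k + 1)` becomes the complementary index; the
last summand `(n + 2) ^ (n + 1)` has been moved to the right. -/
lemma abel_identity (n : ℕ) :
    ∑ p ∈ Finset.HasAntidiagonal.antidiagonal n, ((n + 2).choose (p.1 + 1) : ℚ) * (p.1 + 1) ^ p.1 *
      (p.2 + 1) ^ (p.2 + 1) = (n + 1) * (n + 2) ^ (n + 1) := by
  have h := congrArg (Polynomial.eval (n + 2 : ℚ)) (abelPoly_eq (n + 1))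
  unfold abelPoly at h
  rw [Polynomial.eval_finsetSum, Finset.sum_range_succ] at h
  simp only [Polynomial.eval_mul, Polynomial.eval_C, Polynomial.eval_pow, Polynomial.eval_sub,
    Polynomial.eval_X] at h
  rw [Finset.Nat.sum_antidiagonal_eq_sum_range_succ
    (fun i j => ((n + 2).choose (i + 1) : ℚ) * (i + 1) ^ i * (j + 1) ^ (j + 1))]
  have e : ∀ k ∈ Finset.range (n + 1), ((n + 2).choose (k + 1) : ℚ) * (k + 1) ^ k *
      (((n - k : ℕ) : ℚ) + 1) ^ (n - k + 1) = ((n + 1 + 1).choose (k + 1) : ℚ) * (k + 1) ^ k *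
      (n + 2 - (k + 1 : ℚ)) ^ (n + 1 + 1 - 1 - k) := by
    intro k hk
    have hk' := Finset.mem_range.1 hk
    rw [Nat.cast_sub (by omega), show n + 1 + 1 - 1 - k = n - k + 1 by omega]
    congr 2
    ring
  rw [Finset.sum_congr rfl e]
  simp only [Nat.choose_self] at h
  push_cast at h ⊢
  rw [show (n : ℚ) + 1 + 1 = n + 2 by ring] at h
  simp only [Nat.sub_self, pow_zero] at h
  linear_combination h

/-! ### The tree function and its functional equation -/

/-- The coefficient of `z ^ (n + 1)` in the tree function. -/
noncomputable def treeCoeff (n : ℕ) : ℝ := ((n : ℝ) + 1) ^ n / (n + 1).factorial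

lemma treeCoeff_nonneg (n : ℕ) : 0 ≤ treeCoeff n := by unfold treeCoeff; positivity

/-- Abel's identity divided by `(n + 2)!`. It is the coefficient form of `A' = A T'` with `A = T /
z`. -/
lemma sum_treeCoeff (n : ℕ) :
    ∑ p ∈ Finset.HasAntidiagonal.antidiagonal n, treeCoeff p.1 * ((p.2 + 1) * treeCoeff p.2) =
      (n + 1) * treeCoeff (n + 1) := by
  have h := congrArg (fun x : ℚ => (x : ℝ)) (abel_identity n)
  push_cast at h
  have e : ∀ p ∈ Finset.HasAntidiagonal.antidiagonal n, treeCoeff p.1 * ((p.2 + 1) * treeCoeff p.2) =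
      (((n + 2).choose (p.1 + 1) : ℝ) * (p.1 + 1) ^ p.1 * (p.2 + 1) ^ (p.2 + 1)) /
        (n + 2).factorial := by
    rintro ⟨i, j⟩ hp
    rw [Finset.HasAntidiagonal.mem_antidiagonal] at hp
    simp only at hp ⊢
    have hc : ((n + 2).choose (i + 1) : ℝ) * (i + 1).factorial * (j + 1).factorial =
        (n + 2).factorial := by
      have := Nat.choose_mul_factorial_mul_factorial (n := n + 2) (k := i + 1) (by omega)
      rw [show n + 2 - (i + 1) = j + 1 by omega] at this
      exact_mod_cast this
    unfold treeCoeff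
    have h1 : ((n + 2).choose (i + 1) : ℝ) ≠ 0 := by
      exact_mod_cast (Nat.choose_pos (by omega)).ne'
    have h2 : ((i + 1).factorial : ℝ) ≠ 0 := by positivity
    have h3 : ((j + 1).factorial : ℝ) ≠ 0 := by positivity
    rw [← hc]
    field_simp
    ring
  rw [Finset.sum_congr rfl e, ← Finset.sum_div, h]
  unfold treeCoeff
  push_cast
  rw [show (n : ℝ) + 1 + 1 = n + 2 by ring]
  ring

/-- The bound `N ^ N / N! ≤ e ^ N` at `N = n + 1`; it yields absolute convergence of `T / z` and of
`T'` for `‖z‖ < e⁻¹`. -/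
lemma succ_mul_treeCoeff_le (n : ℕ) : (n + 1) * treeCoeff n ≤ Real.exp 1 ^ (n + 1) := by
  have h := Real.pow_div_factorial_le_exp ((n : ℝ) + 1) (by positivity) (n + 1)
  rw [← Real.exp_nat_mul]
  unfold treeCoeff
  push_cast
  rw [mul_one]
  refine le_trans (le_of_eq ?_) h
  ring

lemma treeCoeff_le (n : ℕ) : treeCoeff n ≤ Real.exp 1 ^ (n + 1) :=
  (le_mul_of_one_le_left (treeCoeff_nonneg n) (by simp)).trans (succ_mul_treeCoeff_le n)

/-- The series `T(z) / z`. -/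
noncomputable def treeQuot (z : ℂ) : ℂ := ∑' n : ℕ, (treeCoeff n : ℂ) * z ^ n

lemma treeFunction_eq (z : ℂ) : treeFunction z = z * treeQuot z := by
  unfold treeFunction treeQuot
  rw [← tsum_mul_left]
  refine tsum_congr fun n => ?_
  unfold treeCoeff
  push_cast
  ring

lemma summable_exp_one_pow {s : ℝ} (hs0 : 0 ≤ s) (hs : s < Real.exp (-1)) :
    Summable fun n : ℕ => Real.exp 1 ^ (n + 1) * s ^ n := by
  have : (fun n : ℕ => Real.exp 1 ^ (n + 1) * s ^ n) =
      fun n : ℕ => Real.exp 1 * (Real.exp 1 * s) ^ n := by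
    ext n; rw [mul_pow]; ring
  rw [this]
  refine (summable_geometric_of_lt_one (by positivity) ?_).mul_left _
  rw [Real.exp_neg] at hs
  calc Real.exp 1 * s < Real.exp 1 * (Real.exp 1)⁻¹ := by gcongr
    _ = 1 := mul_inv_cancel₀ (Real.exp_pos 1).ne'

lemma summable_treeCoeff {z : ℂ} (hz : ‖z‖ < Real.exp (-1)) :
    Summable fun n : ℕ => ‖(treeCoeff n : ℂ) * z ^ n‖ := by
  refine Summable.of_nonneg_of_le (fun n => norm_nonneg _) (fun n => ?_)
    (summable_exp_one_pow (norm_nonneg z) hz)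
  rw [norm_mul, norm_pow, Complex.norm_real, Real.norm_of_nonneg (treeCoeff_nonneg n)]
  gcongr
  exact treeCoeff_le n

lemma summable_succ_mul_treeCoeff {z : ℂ} (hz : ‖z‖ < Real.exp (-1)) :
    Summable fun n : ℕ => ‖((n + 1) * treeCoeff n : ℂ) * z ^ n‖ := by
  refine Summable.of_nonneg_of_le (fun n => norm_nonneg _) (fun n => ?_)
    (summable_exp_one_pow (norm_nonneg z) hz)
  rw [norm_mul, norm_pow]
  gcongr
  have : ((n : ℂ) + 1) * treeCoeff n = (((n + 1) * treeCoeff n : ℝ) : ℂ) := by push_cast; ring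
  rw [this, Complex.norm_real, Real.norm_of_nonneg]
  · exact succ_mul_treeCoeff_le n
  · have := treeCoeff_nonneg n
    positivity

lemma hasDerivAt_treeQuot {z : ℂ} (hz : ‖z‖ < Real.exp (-1)) :
    HasDerivAt treeQuot (∑' n : ℕ, (treeCoeff n : ℂ) * (n * z ^ (n - 1))) z := by
  obtain ⟨s, hzs, hs⟩ := exists_between hz
  have hs0 : 0 < s := (norm_nonneg z).trans_lt hzs
  refine hasDerivAt_tsum_of_isPreconnected (t := Metric.ball (0 : ℂ) s)
    (g := fun n z => (treeCoeff n : ℂ) * z ^ n)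
    (g' := fun n z => (treeCoeff n : ℂ) * (n * z ^ (n - 1)))
    (u := fun n => (Real.exp 1 ^ (n + 1) * s ^ n) * s⁻¹) (y₀ := 0) (y := z)
    ((summable_exp_one_pow hs0.le hs).mul_right _) Metric.isOpen_ball
    (convex_ball (0 : ℂ) s).isPreconnected ?_ ?_ (by simpa using hs0) ?_ (by simpa using hzs)
  · intro n y _
    exact (hasDerivAt_pow n y).const_mul _
  · intro n y hy
    have hy' : ‖y‖ ≤ s := by simpa using (Metric.mem_ball.1 hy).le
    rw [norm_mul, norm_mul, norm_pow, Complex.norm_real, Real.norm_of_nonneg (treeCoeff_nonneg n),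
      Complex.norm_natCast]
    rcases n with _ | n
    · simp; positivity
    · have h1 : s ^ (n + 1) * s⁻¹ = s ^ n := by
        rw [pow_succ, mul_assoc, mul_inv_cancel₀ hs0.ne', mul_one]
      rw [mul_assoc, h1, ← mul_assoc, add_tsub_cancel_right]
      gcongr
      refine le_trans ?_ (succ_mul_treeCoeff_le (n + 1))
      rw [mul_comm]
      have := treeCoeff_nonneg (n + 1)
      gcongr
      simp
  · exact (summable_treeCoeff (z := 0) (by simpa using Real.exp_pos _)).of_norm

lemma deriv_treeQuot_eq {z : ℂ} (hz : ‖z‖ < Real.exp (-1)) :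
    ∑' n : ℕ, (treeCoeff n : ℂ) * (n * z ^ (n - 1)) =
      treeQuot z * ∑' n : ℕ, ((n + 1) * treeCoeff n : ℂ) * z ^ n := by
  unfold treeQuot
  rw [tsum_mul_tsum_eq_tsum_sum_antidiagonal_of_summable_norm (summable_treeCoeff hz)
    (summable_succ_mul_treeCoeff hz)]
  have hsum : Summable fun n : ℕ => (treeCoeff n : ℂ) * (n * z ^ (n - 1)) := by
    rcases eq_or_ne z 0 with rfl | h0
    · refine summable_of_hasFiniteSupport ((Set.finite_le_nat 1).subset fun n hn => ?_)
      by_contra h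
      simp only [Set.mem_ofPred_eq, not_le] at h
      exact hn (by simp [show n - 1 ≠ 0 by omega])
    · refine Summable.of_norm ?_
      have := ((summable_succ_mul_treeCoeff hz).mul_right (‖z‖⁻¹))
      refine Summable.of_nonneg_of_le (fun n => norm_nonneg _) (fun n => ?_) this
      rw [norm_mul, norm_mul, norm_mul, norm_mul, norm_pow, norm_pow, Complex.norm_natCast]
      have h1 : ‖(n : ℂ) + 1‖ = n + 1 := by
        rw [← Nat.cast_succ, Complex.norm_natCast]; push_cast; rfl
      rw [h1]
      rcases n with _ | n
      · simp; positivity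
      · have h1 : ‖z‖ ^ (n + 1) * ‖z‖⁻¹ = ‖z‖ ^ n := by
          rw [pow_succ, mul_assoc, mul_inv_cancel₀ (norm_ne_zero_iff.2 h0), mul_one]
        rw [mul_assoc _ (‖z‖ ^ (n + 1)), h1, add_tsub_cancel_right]
        rw [mul_comm (_ + 1), mul_assoc]
        gcongr
        simp
  rw [hsum.tsum_eq_zero_add]
  simp only [CharP.cast_eq_zero, zero_mul, mul_zero, zero_add, add_tsub_cancel_right]
  refine tsum_congr fun n => ?_
  have h := congrArg (fun x : ℝ => (x : ℂ)) (sum_treeCoeff n)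
  push_cast at h
  have e : ∀ p ∈ Finset.HasAntidiagonal.antidiagonal n, (treeCoeff p.1 : ℂ) * z ^ p.1 *
      (((p.2 + 1) * treeCoeff p.2 : ℂ) * z ^ p.2) =
      (treeCoeff p.1 * ((p.2 + 1) * treeCoeff p.2)) * z ^ n := by
    rintro ⟨i, j⟩ hp
    rw [Finset.HasAntidiagonal.mem_antidiagonal] at hp
    simp only at hp ⊢
    rw [← hp, pow_add]; ring
  rw [Finset.sum_congr rfl e, ← Finset.sum_mul, h]
  push_cast
  ring

/-- With `A = T / z`, the equation `A' = A T'` says that `A e^(-T)` has derivative zero on the disc,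
and its value at `0` is `1`. -/
lemma treeQuot_mul_exp {z : ℂ} (hz : ‖z‖ < Real.exp (-1)) :
    treeQuot z * Complex.exp (-treeFunction z) = 1 := by
  set f : ℂ → ℂ := fun z => treeQuot z * Complex.exp (-(z * treeQuot z)) with hf
  have hd : ∀ w ∈ Metric.ball (0 : ℂ) (Real.exp (-1)), HasDerivAt f 0 w := by
    intro w hw
    have hw' : ‖w‖ < Real.exp (-1) := by simpa using hw
    have h1 := hasDerivAt_treeQuot hw'
    have h2 := h1.mul (((hasDerivAt_id w).mul h1).neg.cexp)
    refine h2.congr_deriv ?_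
    set D := ∑' n : ℕ, (treeCoeff n : ℂ) * (n * w ^ (n - 1)) with hD
    -- The product rule `T' = A + z A'`, on the level of series.
    have h3 : ∑' n : ℕ, ((n + 1) * treeCoeff n : ℂ) * w ^ n = treeQuot w + w * D := by
      have hs : Summable fun n : ℕ => (treeCoeff n : ℂ) * (n * w ^ n) := by
        have := (summable_succ_mul_treeCoeff hw').of_norm.sub (summable_treeCoeff hw').of_norm
        refine this.congr fun n => ?_
        ring
      have h4 : w * D = ∑' n : ℕ, (treeCoeff n : ℂ) * (n * w ^ n) := by
        rw [hD, ← tsum_mul_left]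
        refine tsum_congr fun n => ?_
        rcases n with _ | n
        · simp
        · simp only [add_tsub_cancel_right, pow_succ]; ring
      rw [h4]
      unfold treeQuot
      rw [← (summable_treeCoeff hw').of_norm.tsum_add hs]
      refine tsum_congr fun n => ?_
      ring
    have h5 := deriv_treeQuot_eq hw'
    rw [← hD, h3] at h5
    simp only [id_eq, Pi.mul_apply, Pi.neg_apply]
    linear_combination Complex.exp (-(w * treeQuot w)) * h5
  have hconst : f z = f 0 := by
    refine (convex_ball (0 : ℂ) (Real.exp (-1))).is_const_of_fderivWithin_eq_zero (𝕜 := ℂ)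
      (fun w hw => (hd w hw).differentiableAt.differentiableWithinAt) (fun w hw => ?_)
      (by simpa using hz) (by simpa using Real.exp_pos _)
    rw [fderivWithin_of_isOpen Metric.isOpen_ball hw]
    ext
    simp [(hd w hw).deriv]
  have h0 : f 0 = 1 := by
    simp only [hf, treeQuot, zero_mul, neg_zero, Complex.exp_zero, mul_one]
    rw [tsum_eq_single 0 (fun n hn => by simp [hn])]
    simp [treeCoeff]
  rw [treeFunction_eq, ← h0, ← hconst]

/-- The functional equation `T(z) e^{-T(z)} = z` of the tree function. -/
lemma treeFunction_mul_exp {z : ℂ} (hz : ‖z‖ < Real.exp (-1)) :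
    treeFunction z * Complex.exp (-treeFunction z) = z := by
  have := treeQuot_mul_exp hz
  nth_rewrite 1 [treeFunction_eq]
  rw [mul_assoc, this, mul_one]

/-! ### The real tree function as the inverse of `x e^(-x)` on `[0, 1)` -/

/-- The tree function on the nonnegative reals. -/
noncomputable def realTree (x : ℝ) : ℝ := x * ∑' n : ℕ, treeCoeff n * x ^ n

lemma treeFunction_ofReal (x : ℝ) : treeFunction x = realTree x := by
  rw [treeFunction_eq, realTree, treeQuot]
  push_cast
  rfl

lemma norm_treeFunction_le {z : ℂ} (hz : ‖z‖ < Real.exp (-1)) :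
    ‖treeFunction z‖ ≤ realTree ‖z‖ := by
  rw [treeFunction_eq, norm_mul, realTree]
  gcongr
  refine (norm_tsum_le_tsum_norm (summable_treeCoeff hz)).trans (le_of_eq ?_)
  refine tsum_congr fun n => ?_
  rw [norm_mul, norm_pow, Complex.norm_real, Real.norm_of_nonneg (treeCoeff_nonneg n)]

lemma realTree_mul_exp {x : ℝ} (hx0 : 0 ≤ x) (hx : x < Real.exp (-1)) :
    realTree x * Real.exp (-realTree x) = x := by
  have h := treeFunction_mul_exp (z := (x : ℂ)) (by simpa [abs_of_nonneg hx0] using hx)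
  rw [treeFunction_ofReal] at h
  exact_mod_cast h

lemma continuousOn_realTree : ContinuousOn realTree (Set.Ico 0 (Real.exp (-1))) := by
  have h : ContinuousOn (fun x : ℝ => (treeFunction x).re) (Set.Ico 0 (Real.exp (-1))) := by
    refine Complex.continuous_re.comp_continuousOn ?_
    simp_rw [treeFunction_eq]
    intro x hx
    have h1 : ‖(x : ℂ)‖ < Real.exp (-1) := by simpa [abs_of_nonneg hx.1] using hx.2
    have h2 : ContinuousAt (fun z : ℂ => z * treeQuot z) x :=
      continuousAt_id.mul (hasDerivAt_treeQuot h1).continuousAt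
    exact (ContinuousAt.comp (f := fun x : ℝ => (x : ℂ)) h2
      Complex.continuous_ofReal.continuousAt).continuousWithinAt
  refine h.congr fun x _ => ?_
  simp only [treeFunction_ofReal, Complex.ofReal_re]

lemma mul_exp_neg_strictMonoOn : StrictMonoOn (fun x : ℝ => x * Real.exp (-x)) (Set.Icc 0 1) := by
  refine strictMonoOn_of_deriv_pos (convex_Icc 0 1) (by fun_prop) fun x hx => ?_
  rw [interior_Icc] at hx
  have h : HasDerivAt (fun x : ℝ => x * Real.exp (-x))
      (1 * Real.exp (-x) + x * (Real.exp (-x) * (-1))) x :=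
    (hasDerivAt_id x).mul ((hasDerivAt_neg x).exp)
  rw [h.deriv]
  have := Real.exp_pos (-x)
  nlinarith [hx.2]

lemma mul_exp_neg_lt {a : ℝ} (h0 : 0 ≤ a) (h1 : a < 1) :
    a * Real.exp (-a) < Real.exp (-1) := by
  have := mul_exp_neg_strictMonoOn ⟨h0, h1.le⟩ ⟨zero_le_one, le_rfl⟩ h1
  simpa using this

/-- Otherwise continuity gives a point `y ≤ x` with value exactly `1`, and the functional equation
forces `y = e⁻¹`, outside the range. -/
lemma realTree_lt_one {x : ℝ} (hx0 : 0 ≤ x) (hx : x < Real.exp (-1)) : realTree x < 1 := by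
  by_contra! h
  have hsub : Set.Icc 0 x ⊆ Set.Ico 0 (Real.exp (-1)) := fun y hy => ⟨hy.1, hy.2.trans_lt hx⟩
  have h00 : realTree 0 = 0 := by simp [realTree]
  obtain ⟨y, hy, hy1⟩ := intermediate_value_Icc hx0 (continuousOn_realTree.mono hsub)
    (show (1 : ℝ) ∈ Set.Icc (realTree 0) (realTree x) from ⟨by rw [h00]; exact zero_le_one, h⟩)
  have h2 := realTree_mul_exp hy.1 (hsub hy).2
  rw [hy1, one_mul] at h2
  exact absurd (hsub hy).2 (by rw [← h2]; exact lt_irrefl _)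

lemma realTree_nonneg {x : ℝ} (hx0 : 0 ≤ x) : 0 ≤ realTree x :=
  mul_nonneg hx0 (tsum_nonneg fun n => mul_nonneg (treeCoeff_nonneg n) (by positivity))

lemma realTree_mul_exp_neg {a : ℝ} (h0 : 0 ≤ a) (h1 : a < 1) :
    realTree (a * Real.exp (-a)) = a := by
  have hx0 : 0 ≤ a * Real.exp (-a) := by positivity
  have hx := mul_exp_neg_lt h0 h1
  exact mul_exp_neg_strictMonoOn.injOn ⟨realTree_nonneg hx0, (realTree_lt_one hx0 hx).le⟩
    ⟨h0, h1.le⟩ (realTree_mul_exp hx0 hx)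

/-! ### The numbers `ζ_ℓ` -/

lemma isPrimitiveRoot_rootOmega {b : ℕ} (hb : 1 ≤ b) : IsPrimitiveRoot (rootOmega b) b :=
  Complex.isPrimitiveRoot_exp b (by omega)

lemma norm_zeta_arg {b : ℕ} (hb : 1 ≤ b) {α : ℝ} (hα0 : 0 < α) (l : ℕ) :
    ‖rootOmega b ^ l * α * Complex.exp (-α)‖ = α * Real.exp (-α) := by
  rw [norm_mul, norm_mul, norm_pow, (isPrimitiveRoot_rootOmega hb).norm'_eq_one (by omega), one_pow,
    one_mul, Complex.norm_real, Real.norm_of_nonneg hα0.le, Complex.norm_exp]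
  simp

lemma zetaRoot_mul_exp {b : ℕ} (hb : 1 ≤ b) {α : ℝ} (hα0 : 0 < α) (hα1 : α < 1)
    (l : ℕ) :
    zetaRoot b α l * Complex.exp (-(α * zetaRoot b α l)) = rootOmega b ^ l * Complex.exp (-α) := by
  have hα : (α : ℂ) ≠ 0 := by exact_mod_cast hα0.ne'
  have h := treeFunction_mul_exp (z := rootOmega b ^ l * α * Complex.exp (-α))
    (by rw [norm_zeta_arg hb hα0]; exact mul_exp_neg_lt hα0.le hα1)
  unfold zetaRoot
  rw [mul_div_cancel₀ _ hα, div_mul_eq_mul_div, h]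
  field_simp

/-- The coefficients are nonnegative, so `|T(z)| ≤ T(|z|)`, and `T(α e^(-α)) = α`. -/
lemma norm_zetaRoot_le {b : ℕ} (hb : 1 ≤ b) {α : ℝ} (hα0 : 0 < α) (hα1 : α < 1)
    (l : ℕ) : ‖zetaRoot b α l‖ ≤ 1 := by
  have h := norm_treeFunction_le (z := rootOmega b ^ l * α * Complex.exp (-α))
    (by rw [norm_zeta_arg hb hα0]; exact mul_exp_neg_lt hα0.le hα1)
  rw [norm_zeta_arg hb hα0, realTree_mul_exp_neg hα0.le hα1] at h
  rw [zetaRoot, norm_div, Complex.norm_real, Real.norm_of_nonneg hα0.le]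
  exact (div_le_one hα0).2 h

lemma zetaRoot_zero {b : ℕ} {α : ℝ} (hα0 : 0 < α) (hα1 : α < 1) : zetaRoot b α 0 = 1 := by
  have hα : (α : ℂ) ≠ 0 := by exact_mod_cast hα0.ne'
  have : rootOmega b ^ 0 * α * Complex.exp (-α) = ((α * Real.exp (-α) : ℝ) : ℂ) := by
    push_cast; ring
  rw [zetaRoot, this, treeFunction_ofReal, realTree_mul_exp_neg hα0.le hα1, div_self hα]

/-- The map `ζ ↦ ζ e^(-αζ)` takes the distinct values `ω^ℓ e^(-α)` at these points. -/
lemma zetaRoot_injOn {b : ℕ} (hb : 1 ≤ b) {α : ℝ} (hα0 : 0 < α) (hα1 : α < 1) : Set.InjOn (zetaRoot b α) (Finset.range b) := by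
  intro k hk l hl h
  have h1 := zetaRoot_mul_exp hb hα0 hα1 k
  rw [h, zetaRoot_mul_exp hb hα0 hα1 l] at h1
  have h2 := mul_right_cancel₀ (Complex.exp_ne_zero _) h1
  exact ((isPrimitiveRoot_rootOmega hb).pow_inj (Finset.mem_range.1 hl)
    (Finset.mem_range.1 hk) h2).symm

/-- Taking `b`-th powers removes the root of unity: every `ζ_ℓ` is a zero of the denominator of
`overflowFormula`. -/
lemma zetaRoot_pow {b : ℕ} (hb : 1 ≤ b) {α : ℝ} (hα0 : 0 < α) (hα1 : α < 1)
    (l : ℕ) :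
    zetaRoot b α l ^ b = Complex.exp (α * b * (zetaRoot b α l - 1)) := by
  have h := congrArg (· ^ b) (zetaRoot_mul_exp hb hα0 hα1 l)
  simp only [mul_pow, ← Complex.exp_nat_mul] at h
  rw [← pow_mul, mul_comm l b, pow_mul, (isPrimitiveRoot_rootOmega hb).pow_eq_one, one_pow,
    one_mul] at h
  have h2 : zetaRoot b α l ^ b = Complex.exp (b * -α) / Complex.exp (b * -(α * zetaRoot b α l)) := by
    rw [← h, mul_div_assoc, div_self (Complex.exp_ne_zero _), mul_one]
  rw [h2, ← Complex.exp_sub]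
  congr 1
  ring

/-! ### Partial sums and the hashing equations on `ℤ` -/

/-- The partial sums `∑_{k < l} (u k - b)`. -/
def drift (b : ℕ) (u : ℕ → ℕ) (l : ℕ) : ℤ := ∑ k ∈ Finset.range l, ((u k : ℤ) - b)

/-- The sequence `X` read backwards from `i`. -/
def backward (X : ℤ → ℕ) (i : ℤ) (k : ℕ) : ℕ := X (i - k)

@[simp] lemma drift_zero (b : ℕ) (u : ℕ → ℕ) : drift b u 0 = 0 := by simp [drift]

lemma drift_eq (b : ℕ) (u : ℕ → ℕ) (l : ℕ) :
    drift b u l = (∑ k ∈ Finset.range l, (u k : ℤ)) - b * l := by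
  simp [drift, mul_comm]

lemma drift_backward_succ (b : ℕ) (X : ℤ → ℕ) (i : ℤ) (l : ℕ) :
    drift b (backward X i) (l + 1) = X i - b + drift b (backward X (i - 1)) l := by
  unfold drift backward
  rw [Finset.sum_range_succ', add_comm]
  congr 1
  · simp
  · refine Finset.sum_congr rfl fun k _ => ?_
    rw [show i - ((k + 1 : ℕ) : ℤ) = i - 1 - k by push_cast; ring]

lemma sum_Ioc_eq_drift (b : ℕ) (X : ℤ → ℕ) (i : ℤ) (l : ℕ) :
    ∑ k ∈ Finset.Ioc (i - l) i, ((X k : ℤ) - b) = drift b (backward X i) l := by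
  induction l generalizing i with
  | zero => simp
  | succ l ih =>
    rw [drift_backward_succ, ← ih (i - 1)]
    have h : Finset.Ioc (i - ((l + 1 : ℕ) : ℤ)) i = insert i (Finset.Ioc (i - 1 - l) (i - 1)) := by
      ext x
      simp only [Finset.mem_Ioc, Finset.mem_insert]
      push_cast
      omega
    rw [h, Finset.sum_insert (by simp)]

lemma iSup_Iic_eq_iSup_drift (b : ℕ) (X : ℤ → ℕ) (i : ℤ) :
    (⨆ j : Set.Iic i, ∑ k ∈ Finset.Ioc (j : ℤ) i, ((X k : ℤ) - b)) =
      ⨆ l : ℕ, drift b (backward X i) l := by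
  unfold iSup
  congr 1
  ext x
  constructor
  · rintro ⟨⟨j, hj⟩, rfl⟩
    refine ⟨(i - j).toNat, ?_⟩
    have hj' : j ≤ i := hj
    simp only
    rw [← sum_Ioc_eq_drift, Int.toNat_of_nonneg (by omega), sub_sub_cancel]
  · rintro ⟨l, rfl⟩
    exact ⟨⟨i - l, by simp⟩, sum_Ioc_eq_drift b X i l⟩

lemma overflowZ_eq_of_isGreatest {b : ℕ} {X : ℤ → ℕ} {i : ℤ} {q : ℕ}
    (h : IsGreatest (Set.range (drift b (backward X i))) (q : ℤ)) : overflowZ b X i = q := by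
  unfold overflowZ
  rw [iSup_Iic_eq_iSup_drift, iSup, h.csSup_eq, Int.toNat_natCast]

lemma isGreatest_overflowZ {b : ℕ} {X : ℤ → ℕ} {i : ℤ}
    (h : BddAbove (Set.range (drift b (backward X i)))) :
    IsGreatest (Set.range (drift b (backward X i))) (overflowZ b X i : ℤ) := by
  have hne : (Set.range (drift b (backward X i))).Nonempty := Set.range_nonempty _
  have h1 : 0 ≤ sSup (Set.range (drift b (backward X i))) :=
    le_csSup h ⟨0, drift_zero _ _⟩
  unfold overflowZ
  rw [iSup_Iic_eq_iSup_drift, iSup, Int.toNat_of_nonneg h1]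
  exact ⟨Int.csSup_mem hne h, fun x hx => le_csSup h hx⟩

/-- Iterate `Q i ≥ X i - b + Q (i - 1)` and end with `Q ≥ 0`. -/
lemma drift_le_of_hashingEquations {b : ℕ} {X H Q : ℤ → ℕ} (h : HashingEquations b X H Q)
    (i : ℤ) (l : ℕ) : drift b (backward X i) l ≤ Q i := by
  induction l generalizing i with
  | zero => simp
  | succ l ih =>
    rw [drift_backward_succ]
    have h1 := ih (i - 1)
    have h2 := h i
    omega

/-- The inequality `Q i ≥ X i - b + Q (i - 1)` is an equality wherever `Q i` is positive, so
unrolling it back to the last place without overflow gives an exact partial sum. One such place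
suffices. -/
lemma exists_eq_drift_of_hashingEquations {b : ℕ} {X H Q : ℤ → ℕ} (h : HashingEquations b X H Q)
    (i : ℤ) (l : ℕ) (hl : Q (i - l) = 0) : ∃ l', drift b (backward X i) l' = Q i := by
  induction l generalizing i with
  | zero => exact ⟨0, by simp_all⟩
  | succ l ih =>
    obtain ⟨l', hl'⟩ := ih (i - 1) (by rw [← hl]; congr 1; push_cast; ring)
    have h2 := h i
    by_cases h0 : Q i = 0
    · exact ⟨0, by simp [h0]⟩
    · refine ⟨l' + 1, ?_⟩
      rw [drift_backward_succ, hl']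
      omega

lemma hashingEquations_overflowZ {b : ℕ} {X : ℤ → ℕ}
    (h : ∀ i, BddAbove (Set.range (drift b (backward X i)))) :
    HashingEquations b X (profileZ b X) (overflowZ b X) := by
  refine fun i => ⟨rfl, ?_⟩
  refine overflowZ_eq_of_isGreatest ⟨?_, ?_⟩
  · obtain ⟨l, hl⟩ := (isGreatest_overflowZ (h (i - 1))).1
    rcases le_total (profileZ b X i) b with h0 | h0
    · exact ⟨0, by simp [Nat.sub_eq_zero_of_le h0]⟩
    · refine ⟨l + 1, ?_⟩
      rw [drift_backward_succ, hl]
      unfold profileZ at h0 ⊢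
      omega
  · rintro _ ⟨l, rfl⟩
    rcases l with _ | l
    · simp
    · rw [drift_backward_succ]
      have := (isGreatest_overflowZ (h (i - 1))).2 ⟨l, rfl⟩
      unfold profileZ
      omega

/-- If the partial sums are bounded above, then the maximal partial sums yield the smallest
solution of the hashing equations. -/
lemma isMinimalHashing_overflowZ {b : ℕ} {X : ℤ → ℕ}
    (h : ∀ i, BddAbove (Set.range (drift b (backward X i)))) :
    IsMinimalHashing b X (profileZ b X) (overflowZ b X) := by
  refine ⟨hashingEquations_overflowZ h, fun H' Q' h' => ?_⟩
  have hQ : ∀ i, overflowZ b X i ≤ Q' i := fun i => by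
    obtain ⟨l, hl⟩ := (isGreatest_overflowZ (h i)).1
    have := drift_le_of_hashingEquations h' i l
    omega
  intro i
  refine ⟨?_, hQ i⟩
  have := hQ (i - 1)
  have := (h' i).1
  unfold profileZ
  omega

/-! ### The cyclic table -/

/-- The relations between the three counts of a table into which the keys with the addresses in
`L` have been entered. -/
structure TableState.Balanced {m : ℕ} (b : ℕ) (s : TableState m) (L : List (ZMod m)) : Prop where
  stored_eq : ∀ i, s.stored i = min b (s.tried i)
  tried_eq : ∀ i, s.tried i = L.count i + s.passed (i - 1)
  passed_eq : ∀ i, s.passed i = s.tried i - b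

/-- Keys passed on by a bucket arrive at the next one, so the `passed` terms cancel on summing
around the cycle. -/
lemma TableState.Balanced.sum_stored {m b : ℕ} [NeZero m] {s : TableState m} {L : List (ZMod m)}
    (h : s.Balanced b L) : ∑ i, s.stored i = L.length := by
  have h1 : ∀ i, s.stored i + s.passed i = L.count i + s.passed (i - 1) := fun i => by
    have := h.stored_eq i
    have := h.tried_eq i
    have := h.passed_eq i
    omega
  have h2 := Finset.sum_congr (s₁ := Finset.univ) rfl fun i _ => h1 i
  rw [Finset.sum_add_distrib, Finset.sum_add_distrib,
    show ∑ i, s.passed (i - 1) = ∑ i, s.passed i from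
      Equiv.sum_comp (Equiv.subRight (1 : ZMod m)) s.passed] at h2
  have h3 : ∑ i, L.count i = L.length := by
    rw [← Multiset.coe_card, ← Multiset.sum_count_eq_card (s := Finset.univ) (by simp)]
    simp
  omega

lemma TableState.Balanced.exists_stored_lt {m b : ℕ} [NeZero m] {s : TableState m}
    {L : List (ZMod m)} (h : s.Balanced b L) (hL : L.length < b * m) : ∃ i, s.stored i < b := by
  by_contra! hc
  have := Finset.sum_le_sum fun i (_ : i ∈ Finset.univ) => hc i
  rw [h.sum_stored] at this
  simp [ZMod.card] at this
  rw [mul_comm] at this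
  omega

lemma zmod_add_natCast_inj {m : ℕ} {a : ZMod m} {d e : ℕ} (hd : d < m) (he : e < m)
    (h : a + d = a + e) : d = e := by
  have := (ZMod.natCast_eq_natCast_iff' d e m).1 (add_left_cancel h)
  rwa [Nat.mod_eq_of_lt hd, Nat.mod_eq_of_lt he] at this

lemma TableState.Balanced.insert {m b : ℕ} [NeZero m] {s : TableState m} {L : List (ZMod m)}
    (h : s.Balanced b L) (hL : L.length < b * m) (a : ZMod m) :
    (s.insert b a).Balanced b (L ++ [a]) := by
  obtain ⟨z, hz⟩ := h.exists_stored_lt hL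
  have hmem : (z - a).val ∈ {d : ℕ | s.stored (a + d) < b} := by
    simpa using hz
  set d := sInf {d : ℕ | s.stored (a + d) < b} with hd
  have hd1 : s.stored (a + d) < b := Nat.sInf_mem (s := {d : ℕ | s.stored (a + d) < b}) ⟨_, hmem⟩
  have hd2 : ∀ e < d, b ≤ s.stored (a + e) := fun e he => by
    by_contra! hc
    exact Nat.notMem_of_lt_sInf he hc
  -- The probe path does not wrap around the table, so each bucket on it is tried exactly once.
  have hdm : d < m := (Nat.sInf_le hmem).trans_lt (ZMod.val_lt _)
  have hP : ∀ i : ZMod m, (∃ e : ℕ, e ≤ d ∧ i = a + e) ↔ (∃ e : ℕ, e < d ∧ i = a + e) ∨ i = a + d := by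
    intro i
    constructor
    · rintro ⟨e, he, rfl⟩
      rcases he.lt_or_eq with he | rfl
      · exact Or.inl ⟨e, he, rfl⟩
      · exact Or.inr rfl
    · rintro (⟨e, he, rfl⟩ | rfl)
      · exact ⟨e, he.le, rfl⟩
      · exact ⟨d, le_rfl, rfl⟩
  have hN : ¬ ∃ e : ℕ, e < d ∧ a + (d : ZMod m) = a + e := by
    rintro ⟨e, he, hh⟩
    exact he.ne' (zmod_add_natCast_inj hdm (he.trans hdm) hh)
  have hlow : ∀ i : ZMod m, (∃ e : ℕ, e < d ∧ i = a + e) → b ≤ s.stored i := by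
    rintro i ⟨e, he, rfl⟩
    exact hd2 e he
  refine ⟨fun i => ?_, fun i => ?_, fun i => ?_⟩
  · simp only [TableState.insert, ← hd]
    have h1 := h.stored_eq i
    by_cases hi : i = a + d
    · subst hi
      rw [Function.update_self, if_pos ⟨d, le_rfl, rfl⟩]
      omega
    · rw [Function.update_of_ne hi]
      by_cases hi2 : ∃ e : ℕ, e < d ∧ i = a + e
      · have := hlow i hi2
        rw [if_pos ((hP i).2 (Or.inl hi2))]
        omega
      · rw [if_neg (by rw [hP]; exact fun h => h.elim hi2 hi)]
        omega
  · simp only [TableState.insert, ← hd]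
    have h1 := h.tried_eq i
    have hQ : (∃ e : ℕ, e ≤ d ∧ i = a + e) ↔ a = i ∨ ∃ e : ℕ, e < d ∧ i - 1 = a + e := by
      constructor
      · rintro ⟨e, he, rfl⟩
        rcases e with _ | e
        · left; simp
        · right; exact ⟨e, by omega, by push_cast; ring⟩
      · rintro (rfl | ⟨e, he, hh⟩)
        · exact ⟨0, Nat.zero_le _, by simp⟩
        · exact ⟨e + 1, by omega, by push_cast; rw [← add_assoc, ← hh]; ring⟩
    -- If the address itself were the successor of a passed bucket, the path would have closed up
    -- after `e + 1 ≤ d < m` steps.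
    have hR : a = i → ¬ ∃ e : ℕ, e < d ∧ i - 1 = a + e := by
      rintro rfl ⟨e, he, hh⟩
      have : a + ((0 : ℕ) : ZMod m) = a + ((e + 1 : ℕ) : ZMod m) := by
        push_cast
        rw [← add_assoc, ← hh]; ring
      have := zmod_add_natCast_inj (by omega) (by omega) this
      omega
    rw [List.count_append, List.count_singleton]
    simp only [beq_iff_eq]
    by_cases ha : a = i
    · rw [if_pos (hQ.2 (Or.inl ha)), if_pos ha, if_neg (hR ha)]
      omega
    · by_cases hb : ∃ e : ℕ, e < d ∧ i - 1 = a + e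
      · rw [if_pos (hQ.2 (Or.inr hb)), if_neg ha, if_pos hb]
        omega
      · rw [if_neg (by rw [hQ]; exact fun h => h.elim ha hb), if_neg ha, if_neg hb]
        omega
  · simp only [TableState.insert, ← hd]
    have h1 := h.stored_eq i
    have h2 := h.passed_eq i
    by_cases hi2 : ∃ e : ℕ, e < d ∧ i = a + e
    · have := hlow i hi2
      rw [if_pos ((hP i).2 (Or.inl hi2)), if_pos hi2]
      omega
    · rw [if_neg hi2]
      by_cases hi : i = a + d
      · subst hi
        rw [if_pos ⟨d, le_rfl, rfl⟩]
        omega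
      · rw [if_neg (by rw [hP]; exact fun h => h.elim hi2 hi)]
        omega

lemma balanced_foldl_insert {m b : ℕ} [NeZero m] (L : List (ZMod m)) (hL : L.length ≤ b * m) :
    (L.foldl (TableState.insert b) (TableState.empty m)).Balanced b L := by
  induction L using List.reverseRecOn with
  | nil => exact ⟨fun i => by simp [TableState.empty], fun i => by simp [TableState.empty],
      fun i => by simp [TableState.empty]⟩
  | append_singleton L a ih =>
    rw [List.length_append, List.length_singleton] at hL
    rw [List.foldl_append]
    exact (ih (by omega)).insert (by omega) a

/-- The number of keys with hash address `i`. -/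
def addressCount {m n : ℕ} (h : Fin n → ZMod m) (i : ZMod m) : ℕ :=
  (Finset.univ.filter fun j => h j = i).card

lemma count_ofFn {m n : ℕ} (h : Fin n → ZMod m) (i : ZMod m) :
    (List.ofFn h).count i = addressCount h i := by
  rw [List.ofFn_eq_map, List.count, List.countP_map, addressCount, List.countP_eq_length_filter,
    Fin.univ_def]
  simp [Finset.filter, Function.comp_def]
  congr

lemma hashingEquations_finalTable {b m n : ℕ} [NeZero m] (h : Fin n → ZMod m) (hn : n ≤ b * m) :
    HashingEquations b (fun k : ℤ => addressCount h k) (fun i => profileMN b m n i h)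
      (fun i => overflowMN b m n i h) := by
  have hB := balanced_foldl_insert (b := b) (List.ofFn h) (by simpa using hn)
  refine fun i => ⟨?_, hB.passed_eq i⟩
  have := hB.tried_eq i
  rw [count_ofFn] at this
  simp only [profileMN, overflowMN]
  push_cast
  exact this

lemma sum_addressCount_period {m n : ℕ} [NeZero m] (h : Fin n → ZMod m) (i : ZMod m) :
    ∑ k ∈ Finset.range m, addressCount h (i - k) = n := by
  have h1 : ∑ k ∈ Finset.range m, addressCount h (i - k) = ∑ z : ZMod m, addressCount h z := by
    refine Finset.sum_nbij (fun k => i - (k : ZMod m)) (fun _ _ => Finset.mem_univ _) ?_ ?_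
      (fun _ _ => rfl)
    · intro x hx y hy hxy
      have h2 : (0 : ZMod m) + x = 0 + y := by simpa using hxy
      exact zmod_add_natCast_inj (Finset.mem_range.1 hx) (Finset.mem_range.1 hy) h2
    · intro z _
      exact ⟨(i - z).val, by simpa using ZMod.val_lt _, by simp⟩
  rw [h1]
  unfold addressCount
  rw [← Finset.card_eq_sum_card_fiberwise (f := h) (t := Finset.univ) (by simp)]
  simp

/-- Since `n < b * m`, some bucket is not full, and unrolling the recursion back to it attains the
maximum. The maximiser lies below `m` because a full turn changes the partial sum by `n - b * m <
0`. -/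
lemma isGreatest_overflowMN {b m n : ℕ} [NeZero m] (h : Fin n → ZMod m) (hn : n < b * m) (i : ℤ) :
    (∃ l < m, drift b (backward (fun k : ℤ => addressCount h k) i) l = overflowMN b m n i h) ∧
      ∀ l, drift b (backward (fun k : ℤ => addressCount h k) i) l ≤ overflowMN b m n i h := by
  have hE := hashingEquations_finalTable h hn.le
  have hle := drift_le_of_hashingEquations hE i
  refine ⟨?_, hle⟩
  have hB := balanced_foldl_insert (b := b) (List.ofFn h) (by simpa using hn.le)
  obtain ⟨z, hz⟩ := hB.exists_stored_lt (by simpa using hn)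
  have hz0 : (finalTable b h).passed z = 0 := by
    have h1 := hB.stored_eq z
    have h2 := hB.passed_eq z
    unfold finalTable
    omega
  obtain ⟨l, hl⟩ := exists_eq_drift_of_hashingEquations hE i ((i : ZMod m) - z).val (by
    simp only [overflowMN]
    push_cast
    rw [ZMod.natCast_zmod_val, sub_sub_cancel, hz0])
  refine ⟨l, ?_, hl⟩
  by_contra! hc
  obtain ⟨l', rfl⟩ := Nat.exists_eq_add_of_le' hc
  have hp : drift b (backward (fun k : ℤ => addressCount h k) i) (l' + m) =
      drift b (backward (fun k : ℤ => addressCount h k) i) l' + (n - b * m) := by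
    rw [drift_eq, drift_eq, Finset.sum_range_add]
    have := sum_addressCount_period h ((i - l' : ℤ) : ZMod m)
    have h3 : ∑ k ∈ Finset.range m, (backward (fun k : ℤ => addressCount h k) i (l' + k) : ℤ) =
        n := by
      conv_rhs => rw [← this]
      push_cast
      refine Finset.sum_congr rfl fun k _ => ?_
      simp only [backward]
      push_cast
      rw [sub_sub]
    rw [h3]
    push_cast
    ring
  have h1 := hle l'
  have h2 : (n : ℤ) < b * m := by exact_mod_cast hn
  omega

/-! ### Truncation -/

/-- The maximum of the first partial sums. -/
def truncOverflow (b : ℕ) (u : ℕ → ℕ) (L : ℕ) : ℕ :=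
  (Finset.range (L + 1)).sup fun l => (drift b u l).toNat

lemma drift_congr {b : ℕ} {u v : ℕ → ℕ} {l : ℕ} (h : ∀ k < l, u k = v k) :
    drift b u l = drift b v l :=
  Finset.sum_congr rfl fun k hk => by rw [h k (Finset.mem_range.1 hk)]

lemma truncOverflow_congr {b : ℕ} {u v : ℕ → ℕ} {L : ℕ} (h : ∀ k < L, u k = v k) :
    truncOverflow b u L = truncOverflow b v L :=
  Finset.sup_congr rfl fun l hl => by
    rw [drift_congr fun k hk => h k (by have := Finset.mem_range.1 hl; omega)]

lemma drift_le_truncOverflow {b : ℕ} {u : ℕ → ℕ} {l L : ℕ} (h : l ≤ L) :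
    drift b u l ≤ truncOverflow b u L := by
  have h1 : (drift b u l).toNat ≤ truncOverflow b u L :=
    Finset.le_sup (f := fun l => (drift b u l).toNat) (Finset.mem_range.2 (Nat.lt_succ_of_le h))
  omega

/-- The partial sum of length `k + 1` already contains `u k` and loses at most `b * L`. Consequently
only finitely many windows have a given truncated profile. -/
lemma le_add_truncOverflow {b : ℕ} {u : ℕ → ℕ} {k L : ℕ} (h : k < L) :
    u k ≤ truncOverflow b u L + b * L := by
  have h1 := drift_le_truncOverflow (b := b) (u := u) (show k + 1 ≤ L from h)
  rw [drift_eq, Finset.sum_range_succ] at h1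
  have h2 : (0 : ℤ) ≤ ∑ k ∈ Finset.range k, (u k : ℤ) := Finset.sum_nonneg fun _ _ => by positivity
  have h3 : (b : ℤ) * ((k + 1 : ℕ) : ℤ) ≤ b * L := by gcongr; omega
  have h4 : ((b * L : ℕ) : ℤ) = b * L := by push_cast; rfl
  omega

/-- If truncation misses the maximum, the maximiser lies beyond `L`; the walk is nonnegative there,
an event that becomes exponentially unlikely. -/
lemma exists_drift_pos_of_ne_truncOverflow {b : ℕ} {u : ℕ → ℕ} {q l : ℕ}
    (hl : drift b u l = q) (hle : ∀ l, drift b u l ≤ q) {L : ℕ}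
    (hne : q ≠ truncOverflow b u L) : L < l ∧ 0 ≤ drift b u l := by
  have h1 : truncOverflow b u L ≤ q := Finset.sup_le fun l _ => by have := hle l; omega
  refine ⟨?_, by omega⟩
  by_contra! h
  have := drift_le_truncOverflow (b := b) (u := u) h
  omega

/-! ### Laws on `ℕ` with geometric tails -/

section Tails

variable {E : Type*} [NormedAddCommGroup E]

lemma summable_geometric_tail {ν : Measure ℕ} {C r s : ℝ} (hs : 0 ≤ s)
    (hsr : s < r) (hC : ∀ j, ν.real {j} * r ^ j ≤ C) : Summable fun j => ν.real {j} * s ^ j := by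
  have hr : 0 < r := hs.trans_lt hsr
  refine Summable.of_nonneg_of_le (fun j => by positivity) (fun j => ?_)
    ((summable_geometric_of_lt_one (by positivity) ((div_lt_one hr).2 hsr)).mul_left C)
  have h : ν.real {j} * s ^ j = ν.real {j} * r ^ j * (s / r) ^ j := by
    rw [div_pow]; field_simp
  rw [h]
  gcongr
  exact hC j

lemma integrable_of_tail {ν : Measure ℕ} [IsFiniteMeasure ν] {C r s K : ℝ} (hs : 0 ≤ s)
    (hsr : s < r) (hC : ∀ j, ν.real {j} * r ^ j ≤ C) {f : ℕ → E} (hf : ∀ j, ‖f j‖ ≤ K * s ^ j) :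
    Integrable f ν := by
  rw [← Measure.sum_smul_dirac ν, integrable_sum_dirac_iff (fun j => measure_ne_top _ _)]
  refine Summable.of_nonneg_of_le (fun j => by positivity) (fun j => ?_)
    ((summable_geometric_tail hs hsr hC).mul_left K)
  calc ν.real {j} * ‖f j‖ ≤ ν.real {j} * (K * s ^ j) := by gcongr; exact hf j
    _ = K * (ν.real {j} * s ^ j) := by ring

lemma hasSum_integral_of_tail [NormedSpace ℝ E] [CompleteSpace E] {ν : Measure ℕ} [IsFiniteMeasure ν] {C r s K : ℝ}
    (hs : 0 ≤ s) (hsr : s < r) (hC : ∀ j, ν.real {j} * r ^ j ≤ C) {f : ℕ → E}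
    (hf : ∀ j, ‖f j‖ ≤ K * s ^ j) : HasSum (fun j => ν.real {j} • f j) (∫ j, f j ∂ν) := by
  have hi := integrable_of_tail hs hsr hC hf
  rw [← Measure.sum_smul_dirac ν, integrable_sum_dirac_iff (fun j => measure_ne_top _ _)] at hi
  have := hasSum_integral_sum_dirac (fun j => measure_ne_top ν {j}) hi
  rwa [Measure.sum_smul_dirac] at this

/-- If laws on `ℕ` with uniformly geometric tails converge pointwise, then the integrals of
functions of slower exponential growth converge uniformly. -/
lemma eventually_norm_integral_sub_le [NormedSpace ℝ E] [CompleteSpace E] {ν : ℕ → Measure ℕ}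
    [∀ k, IsFiniteMeasure (ν k)] {ν' : Measure ℕ} [IsFiniteMeasure ν'] {C r s : ℝ} (hs : 0 ≤ s)
    (hsr : s < r) (hC : ∀ᶠ k in atTop, ∀ j, (ν k).real {j} * r ^ j ≤ C)
    (hC' : ∀ j, ν'.real {j} * r ^ j ≤ C)
    (hν : ∀ j, Tendsto (fun k => (ν k).real {j}) atTop (𝓝 (ν'.real {j}))) {K : ℝ}
    {ε : ℝ} (hε : 0 < ε) :
    ∀ᶠ k in atTop, ∀ f : ℕ → E, (∀ j, ‖f j‖ ≤ K * s ^ j) →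
      ‖∫ j, f j ∂ν k - ∫ j, f j ∂ν'‖ ≤ ε := by
  have hr : 0 < r := hs.trans_lt hsr
  -- The weighted `ℓ¹` distance of the laws tends to zero by dominated convergence. It does not
  -- involve `f`, whence the uniformity over all `f` with the same growth bound.
  have hlim : Tendsto (fun k => ∑' j, |(ν k).real {j} - ν'.real {j}| * s ^ j) atTop
      (𝓝 (∑' _ : ℕ, (0 : ℝ))) := by
    refine tendsto_tsum_of_dominated_convergence (bound := fun j => 2 * C * (s / r) ^ j) ?_ ?_ ?_
    · exact (summable_geometric_of_lt_one (by positivity) ((div_lt_one hr).2 hsr)).mul_left _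
    · intro j
      have := (((hν j).sub_const (ν'.real {j})).abs).mul_const (s ^ j)
      simpa using this
    · filter_upwards [hC] with k hk j
      have h1 : |(ν k).real {j} - ν'.real {j}| * r ^ j ≤ 2 * C := by
        have h2 : |(ν k).real {j} - ν'.real {j}| ≤ (ν k).real {j} + ν'.real {j} := by
          rw [abs_le]
          have := measureReal_nonneg (μ := ν k) (s := {j})
          have := measureReal_nonneg (μ := ν') (s := {j})
          constructor <;> linarith
        calc _ ≤ ((ν k).real {j} + ν'.real {j}) * r ^ j := by gcongr
          _ ≤ 2 * C := by linarith [hk j, hC' j]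
      rw [Real.norm_of_nonneg (by positivity)]
      have h : |(ν k).real {j} - ν'.real {j}| * s ^ j =
          |(ν k).real {j} - ν'.real {j}| * r ^ j * (s / r) ^ j := by
        rw [div_pow]; field_simp
      rw [h]
      gcongr
  rw [tsum_zero] at hlim
  have hlim' := hlim.const_mul K
  rw [mul_zero] at hlim'
  filter_upwards [hC, hlim'.eventually_lt_const hε] with k hk hk2 f hf
  have h1 := (hasSum_integral_of_tail hs hsr hk hf).sub (hasSum_integral_of_tail hs hsr hC' hf)
  rw [← h1.tsum_eq]
  have hsum : Summable fun j => K * (|(ν k).real {j} - ν'.real {j}| * s ^ j) := by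
    refine Summable.mul_left _ ?_
    refine Summable.of_nonneg_of_le (fun j => by positivity) (fun j => ?_)
      ((summable_geometric_tail hs hsr hk).add (summable_geometric_tail hs hsr hC'))
    rw [← add_mul]
    gcongr
    rw [abs_le]
    have := measureReal_nonneg (μ := ν k) (s := {j})
    have := measureReal_nonneg (μ := ν') (s := {j})
    constructor <;> linarith
  refine (tsum_of_norm_bounded hsum.hasSum fun j => ?_).trans ?_
  · rw [← sub_smul, norm_smul, Real.norm_eq_abs]
    calc _ ≤ |(ν k).real {j} - ν'.real {j}| * (K * s ^ j) := by gcongr; exact hf j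
      _ = _ := by ring
  · rw [tsum_mul_left]
    exact hk2.le

end Tails

/-! ### Overflow with a geometric bound on the partial sums -/

section Overflow

open scoped ENNReal

variable {Ω : Type*} [MeasurableSpace Ω] {μ : Measure Ω}

lemma lintegral_tsum_geometric_le {g : ℕ → Ω → ℝ≥0∞} {ρ : ℝ≥0∞} (hg : ∀ l, AEMeasurable (g l) μ)
    (hρ : ∀ l, ∫⁻ ω, g l ω ∂μ ≤ ρ ^ l) (L : ℕ) :
    ∫⁻ ω, ∑' l, g (L + l) ω ∂μ ≤ ρ ^ L * (1 - ρ)⁻¹ := by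
  rw [lintegral_tsum fun l => hg _, ← ENNReal.tsum_geometric, ← ENNReal.tsum_mul_left]
  exact ENNReal.tsum_le_tsum fun l => by rw [← pow_add]; exact hρ _

lemma toReal_geometric_le {ρ : ℝ} (h0 : 0 ≤ ρ) (h1 : ρ < 1) (L : ℕ) {x : ℝ≥0∞}
    (hx : x ≤ ENNReal.ofReal ρ ^ L * (1 - ENNReal.ofReal ρ)⁻¹) : x.toReal ≤ ρ ^ L / (1 - ρ) := by
  have h : ENNReal.ofReal ρ ^ L * (1 - ENNReal.ofReal ρ)⁻¹ = ENNReal.ofReal (ρ ^ L / (1 - ρ)) := by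
    rw [div_eq_mul_inv, ENNReal.ofReal_mul (by positivity), ENNReal.ofReal_pow h0,
      ENNReal.ofReal_inv_of_pos (by linarith), ENNReal.ofReal_sub _ h0, ENNReal.ofReal_one]
  rw [h] at hx
  refine ENNReal.toReal_le_of_le_ofReal ?_ hx
  have : 0 < 1 - ρ := by linarith
  positivity

/-- A wrong truncation puts a maximiser at some `l > L` with nonnegative drift, where the weight is
at least `1`; Markov's inequality for the sum of the weights beyond `L` concludes. The weight has to
dominate `r ^ drift` only at one maximising index, which lets `g` be cut off in the cyclic model. -/
lemma measureReal_ne_truncOverflow_le {g : ℕ → Ω → ℝ≥0∞} {ρ r : ℝ} (hr : 1 ≤ r) (h0 : 0 ≤ ρ)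
    (h1 : ρ < 1) (hg : ∀ l, AEMeasurable (g l) μ)
    (hρ : ∀ l, ∫⁻ ω, g l ω ∂μ ≤ ENNReal.ofReal ρ ^ l) {b : ℕ} {u : Ω → ℕ → ℕ} {Q : Ω → ℕ}
    (hQ : ∀ᵐ ω ∂μ, ∃ l, drift b (u ω) l = Q ω ∧ (∀ l', drift b (u ω) l' ≤ Q ω) ∧
      ENNReal.ofReal (r ^ drift b (u ω) l) ≤ g l ω) (L : ℕ) :
    μ.real {ω | Q ω ≠ truncOverflow b (u ω) L} ≤ ρ ^ (L + 1) / (1 - ρ) := by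
  refine toReal_geometric_le h0 h1 (L + 1) ?_
  refine le_trans ?_ (lintegral_tsum_geometric_le hg hρ (L + 1))
  refine le_trans ?_ (mul_meas_ge_le_lintegral₀ (AEMeasurable.tsum fun l => hg _) 1)
  rw [one_mul]
  refine measure_mono_ae ?_
  filter_upwards [hQ] with ω hω hne
  obtain ⟨l, hl, hle, hgl⟩ := hω
  obtain ⟨h2, h3⟩ := exists_drift_pos_of_ne_truncOverflow hl hle hne
  obtain ⟨l', rfl⟩ := Nat.exists_eq_add_of_le (Nat.succ_le_of_lt h2)
  refine le_trans ?_ (ENNReal.le_tsum l')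
  refine le_trans ?_ hgl
  rw [ENNReal.one_le_ofReal]
  exact one_le_zpow₀ hr h3

/-- On `H = j` the maximal partial sum is at least `j - b`, so the sum of the weights is at least `r
^ j / r ^ b`; apply Markov's inequality. -/
lemma measureReal_mul_pow_le [IsFiniteMeasure μ] {g : ℕ → Ω → ℝ≥0∞} {ρ r : ℝ} (hr : 1 ≤ r)
    (h0 : 0 ≤ ρ) (h1 : ρ < 1) (hg : ∀ l, AEMeasurable (g l) μ)
    (hρ : ∀ l, ∫⁻ ω, g l ω ∂μ ≤ ENNReal.ofReal ρ ^ l) {b : ℕ} {u : Ω → ℕ → ℕ} {Q H : Ω → ℕ}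
    (hQ : ∀ᵐ ω ∂μ, ∃ l, drift b (u ω) l = Q ω ∧ (∀ l', drift b (u ω) l' ≤ Q ω) ∧
      ENNReal.ofReal (r ^ drift b (u ω) l) ≤ g l ω) (hH : ∀ᵐ ω ∂μ, H ω ≤ Q ω + b) (j : ℕ) :
    μ.real (H ⁻¹' {j}) * r ^ j ≤ r ^ b / (1 - ρ) := by
  have hr0 : 0 < r := by linarith
  have hj : (ENNReal.ofReal (r ^ j * (r ^ b)⁻¹) * μ (H ⁻¹' {j})).toReal ≤ ρ ^ 0 / (1 - ρ) := by
    refine toReal_geometric_le h0 h1 0 ?_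
    refine le_trans ?_ (lintegral_tsum_geometric_le hg hρ 0)
    refine le_trans ?_ (mul_meas_ge_le_lintegral₀ (AEMeasurable.tsum fun l => hg _)
      (ENNReal.ofReal (r ^ j * (r ^ b)⁻¹)))
    refine mul_le_mul_right (measure_mono_ae ?_) _
    filter_upwards [hQ, hH] with ω hω hHω hj
    obtain ⟨l, hl, hle, hgl⟩ := hω
    have hj' : H ω = j := hj
    refine le_trans ?_ (ENNReal.le_tsum l)
    rw [zero_add]
    refine le_trans (ENNReal.ofReal_le_ofReal ?_) hgl
    rw [hl, zpow_natCast, ← div_eq_mul_inv, div_le_iff₀ (by positivity), ← pow_add]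
    exact pow_le_pow_right₀ hr (by omega)
  rw [ENNReal.toReal_mul, ENNReal.toReal_ofReal (by positivity), pow_zero] at hj
  rw [measureReal_def]
  calc _ = r ^ b * (r ^ j * (r ^ b)⁻¹ * (μ (H ⁻¹' {j})).toReal) := by field_simp
    _ ≤ r ^ b * (1 / (1 - ρ)) := by gcongr
    _ = _ := by ring

end Overflow

/-! ### The truncated profile -/

/-- The profile computed from `L + 1` terms only. -/
def truncProfile (b : ℕ) (v : ℕ → ℕ) (L : ℕ) : ℕ := v 0 + truncOverflow b (fun k => v (k + 1)) L

/-- Extension by zero. -/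
def extendFin {N : ℕ} (x : Fin N → ℕ) (k : ℕ) : ℕ := if h : k < N then x ⟨k, h⟩ else 0

lemma truncProfile_extendFin (b : ℕ) (v : ℕ → ℕ) (L : ℕ) :
    truncProfile b (extendFin fun k : Fin (L + 1) => v k) L = truncProfile b v L := by
  unfold truncProfile
  refine congrArg₂ (· + ·) ?_ ?_
  · simp [extendFin]
  · exact truncOverflow_congr fun k hk => by simp [extendFin, hk]

/-- The finite set of windows for which the truncated profile is `j`. -/
def windowSet (b L j : ℕ) : Finset (Fin (L + 1) → ℕ) :=
  (Fintype.piFinset fun _ => Finset.range (j + b * L + 1)).filter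
    fun x => truncProfile b (extendFin x) L = j

/-- The box in `windowSet` loses nothing: by `le_add_truncOverflow` every coordinate of such a
window is at most `j + b * L`. -/
lemma mem_windowSet_iff (b L j : ℕ) (v : ℕ → ℕ) :
    (fun k : Fin (L + 1) => v k) ∈ windowSet b L j ↔ truncProfile b v L = j := by
  simp only [windowSet, Finset.mem_filter, Fintype.mem_piFinset, truncProfile_extendFin,
    Finset.mem_range, and_iff_right_iff_imp]
  rintro h ⟨k, hk⟩
  simp only [truncProfile] at h ⊢
  rcases k with _ | k
  · have : 0 ≤ b * L := Nat.zero_le _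
    omega
  · have := le_add_truncOverflow (b := b) (u := fun k => v (k + 1)) (show k < L by omega)
    omega

section Window

variable {Ω : Type*} [MeasurableSpace Ω] {μ : Measure Ω} [IsFiniteMeasure μ]

lemma measureReal_truncProfile {V : Ω → ℕ → ℕ} (hV : ∀ k, Measurable fun ω => V ω k)
    (b L j : ℕ) :
    μ.real {ω | truncProfile b (V ω) L = j} =
      ∑ x ∈ windowSet b L j, μ.real {ω | ∀ k : Fin (L + 1), V ω k = x k} := by
  have hm : Measurable fun ω => fun k : Fin (L + 1) => V ω k :=
    measurable_pi_lambda _ fun k => hV k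
  have h := sum_measureReal_preimage_singleton (μ := μ)
    (f := fun ω => fun k : Fin (L + 1) => V ω k) (windowSet b L j)
    (fun y _ => hm (measurableSet_singleton y))
  have h1 : (fun ω => fun k : Fin (L + 1) => V ω k) ⁻¹' ↑(windowSet b L j) =
      {ω | truncProfile b (V ω) L = j} := by
    ext ω
    exact mem_windowSet_iff b L j (V ω)
  rw [h1] at h
  rw [← h]
  refine Finset.sum_congr rfl fun x _ => ?_
  congr 1
  ext ω
  simp [funext_iff]

/-- Both events coincide outside the event that truncation changes the overflow. -/
lemma abs_measureReal_sub_truncProfile_le {V : Ω → ℕ → ℕ} {Q H : Ω → ℕ} {b L : ℕ}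
    (hH : ∀ᵐ ω ∂μ, H ω = V ω 0 + Q ω) (j : ℕ) :
    |μ.real (H ⁻¹' {j}) - μ.real {ω | truncProfile b (V ω) L = j}| ≤
      μ.real {ω | Q ω ≠ truncOverflow b (fun k => V ω (k + 1)) L} := by
  set B := {ω | Q ω ≠ truncOverflow b (fun k => V ω (k + 1)) L} with hB
  have h1 : μ.real (H ⁻¹' {j}) ≤ μ.real {ω | truncProfile b (V ω) L = j} + μ.real B := by
    refine le_trans ?_ (measureReal_union_le _ _)
    refine ENNReal.toReal_mono (measure_ne_top _ _) (measure_mono_ae ?_)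
    filter_upwards [hH] with ω hω hj
    have hj' : H ω = j := hj
    by_cases hb : Q ω = truncOverflow b (fun k => V ω (k + 1)) L
    · left
      change truncProfile b (V ω) L = j
      rw [truncProfile, ← hb, ← hω, hj']
    · exact Or.inr hb
  have h2 : μ.real {ω | truncProfile b (V ω) L = j} ≤ μ.real (H ⁻¹' {j}) + μ.real B := by
    refine le_trans ?_ (measureReal_union_le _ _)
    refine ENNReal.toReal_mono (measure_ne_top _ _) (measure_mono_ae ?_)
    filter_upwards [hH] with ω hω hj
    have hj' : truncProfile b (V ω) L = j := hj
    by_cases hb : Q ω = truncOverflow b (fun k => V ω (k + 1)) L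
    · left
      change H ω = j
      rw [← hj', truncProfile, ← hb, ← hω]
    · exact Or.inr hb
  rw [abs_le]
  constructor <;> linarith

end Window

/-! ### The exact model -/

section Exact

open scoped ENNReal

variable {m n : ℕ}

lemma exactModel_singleton [NeZero m] (h : Fin n → ZMod m) : exactModel m n {h} = ((m : ℝ≥0∞) ^ n)⁻¹ := by
  rw [exactModel, PMF.toMeasure_apply_singleton _ _ (measurableSet_singleton h)]
  simp [ZMod.card]

lemma exactModel_real_eq [NeZero m] (S : Set (Fin n → ZMod m)) [DecidablePred (· ∈ S)] :
    (exactModel m n).real S = (Finset.univ.filter (· ∈ S)).card / (m : ℝ) ^ n := by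
  have h := sum_measureReal_singleton (μ := exactModel m n) (Finset.univ.filter (· ∈ S))
  simp only [Finset.coe_filter, Finset.mem_univ, true_and, Set.ofPred_mem_eq] at h
  rw [← h]
  simp [measureReal_def, exactModel_singleton, div_eq_mul_inv]

lemma addressCount_eq_sum (h : Fin n → ZMod m) (i : ZMod m) :
    addressCount h i = ∑ j, if h j = i then 1 else 0 := by
  rw [addressCount, Finset.card_filter]

lemma sum_ite_eq_sub_le_one {l : ℕ} (hl : l ≤ m) (i z : ZMod m) :
    (∑ k ∈ Finset.range l, if z = i - k then 1 else 0) ≤ 1 := by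
  rw [← Finset.card_filter, Finset.card_le_one]
  intro x hx y hy
  simp only [Finset.mem_filter, Finset.mem_range] at hx hy
  refine zmod_add_natCast_inj (a := (0 : ZMod m)) (by omega) (by omega) ?_
  have h : i - (x : ZMod m) = i - y := hx.2.symm.trans hy.2
  simpa using h

/-- The sum factors over the keys. A single key contributes `r` for each of the `l` addresses in the
window and `1` for the others; `l ≤ m` keeps these addresses distinct. -/
lemma sum_pow_addressCount [NeZero m] {l : ℕ} (hl : l ≤ m) (i : ZMod m) (r : ℝ) :
    ∑ h : Fin n → ZMod m, r ^ ∑ k ∈ Finset.range l, addressCount h (i - k) =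
      (m + (r - 1) * l) ^ n := by
  have h1 : ∀ h : Fin n → ZMod m, r ^ ∑ k ∈ Finset.range l, addressCount h (i - k) =
      ∏ j, r ^ ∑ k ∈ Finset.range l, if h j = i - k then 1 else 0 := by
    intro h
    rw [Finset.prod_pow_eq_pow_sum, Finset.sum_comm]
    simp only [addressCount_eq_sum]
  rw [Finset.sum_congr rfl fun h _ => h1 h, ← Fintype.sum_pow
    (fun z : ZMod m => r ^ ∑ k ∈ Finset.range l, if z = i - k then 1 else 0)]
  congr 1
  have h2 : ∀ z : ZMod m, (r ^ ∑ k ∈ Finset.range l, if z = i - k then 1 else 0) =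
      1 + (r - 1) * ∑ k ∈ Finset.range l, if z = i - k then 1 else 0 := by
    intro z
    have h3 := sum_ite_eq_sub_le_one hl i z
    have h4 : (∑ k ∈ Finset.range l, if z = i - k then (1 : ℝ) else 0) =
        ((∑ k ∈ Finset.range l, if z = i - k then 1 else 0 : ℕ) : ℝ) := by push_cast; rfl
    rw [h4]
    interval_cases (∑ k ∈ Finset.range l, if z = i - k then 1 else 0) <;> simp
  rw [Finset.sum_congr rfl fun z _ => h2 z, Finset.sum_add_distrib, ← Finset.mul_sum,
    Finset.sum_comm]
  simp [ZMod.card]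

/-- By `1 + x ≤ e ^ x`, the exponential moment of the multinomial counts is at most that of
independent Poisson counts with mean `a`. -/
lemma lintegral_exactModel_drift_le [NeZero m] {b l : ℕ} (hl : l ≤ m) (i : ℤ) {r a : ℝ} (hr : 1 ≤ r)
    (ha : (n : ℝ) / m ≤ a) :
    ∫⁻ h, ENNReal.ofReal (r ^ drift b (backward (fun k : ℤ => addressCount h k) i) l)
      ∂exactModel m n ≤ ENNReal.ofReal (Real.exp ((r - 1) * a) / r ^ b) ^ l := by
  have hr0 : 0 < r := by linarith
  have hm : (0 : ℝ) < m := by exact_mod_cast Nat.pos_of_ne_zero (NeZero.ne m)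
  have h1 : ∀ h : Fin n → ZMod m,
      r ^ drift b (backward (fun k : ℤ => addressCount h k) i) l =
        (r ^ ∑ k ∈ Finset.range l, addressCount h ((i : ZMod m) - k)) * ((r ^ b) ^ l)⁻¹ := by
    intro h
    rw [drift_eq, zpow_sub₀ hr0.ne', ← pow_mul, div_eq_mul_inv]
    congr 1
    rw [← zpow_natCast]
    congr 1
    push_cast
    simp [backward]
  rw [lintegral_fintype]
  simp only [exactModel_singleton, h1]
  rw [← Finset.sum_mul, ← ENNReal.ofReal_sum_of_nonneg (fun h _ => by positivity),
    ← Finset.sum_mul, sum_pow_addressCount hl]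
  have hmn : ((m : ℝ≥0∞) ^ n)⁻¹ = ENNReal.ofReal (((m : ℝ) ^ n)⁻¹) := by
    rw [ENNReal.ofReal_inv_of_pos (by positivity), ENNReal.ofReal_pow hm.le, ENNReal.ofReal_natCast]
  rw [hmn, ← ENNReal.ofReal_mul' (by positivity), ← ENNReal.ofReal_pow (by positivity)]
  refine ENNReal.ofReal_le_ofReal ?_
  rw [div_pow, div_eq_mul_inv, mul_right_comm]
  gcongr
  have h2 : ((m : ℝ) + (r - 1) * l) ^ n * ((m : ℝ) ^ n)⁻¹ = (1 + (r - 1) * l / m) ^ n := by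
    rw [← inv_pow, ← mul_pow]
    congr 1
    field_simp
  rw [h2, ← Real.exp_nat_mul]
  have h3 : 0 ≤ (r - 1) * l / m := by
    have : 0 ≤ r - 1 := by linarith
    positivity
  calc (1 + (r - 1) * l / m) ^ n ≤ Real.exp ((r - 1) * l / m) ^ n := by
        gcongr
        rw [add_comm]
        exact Real.add_one_le_exp _
    _ = Real.exp (l * ((r - 1) * (n / m))) := by
        rw [← Real.exp_nat_mul]; congr 1; field_simp
    _ ≤ Real.exp (l * ((r - 1) * a)) := by
        have : 0 ≤ r - 1 := by linarith
        gcongr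

/-! ### Counting windows, and their Poisson limit -/

/-- The number of address vectors with prescribed numbers of keys in the buckets `c k`. -/
def windowCard [NeZero m] (n : ℕ) {N : ℕ} (c : Fin N → ZMod m) (x : Fin N → ℕ) : ℕ :=
  (Finset.univ.filter fun h : Fin n → ZMod m => ∀ k, addressCount h (c k) = x k).card

lemma windowCard_zero [NeZero m] (n : ℕ) {N : ℕ} {c : Fin N → ZMod m} (hc : Function.Injective c) :
    windowCard n c 0 = (m - N) ^ n := by
  have h1 : (Finset.univ.filter fun h : Fin n → ZMod m => ∀ k, addressCount h (c k) = (0 : Fin N → ℕ) k)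
      = Fintype.piFinset fun _ => (Finset.univ.image c)ᶜ := by
    ext h
    simp only [Finset.mem_filter, Finset.mem_univ, true_and, Fintype.mem_piFinset,
      Finset.mem_compl, Finset.mem_image, not_exists, addressCount, Pi.zero_apply,
      Finset.card_eq_zero, Finset.filter_eq_empty_iff]
    exact ⟨fun H j k e => H k trivial e.symm, fun H k j _ e => H j k e.symm⟩
  rw [windowCard, h1, Fintype.card_piFinset]
  simp [Finset.card_compl, ZMod.card, Finset.card_image_of_injective _ hc]

lemma addressCount_insertNth (j : Fin (n + 1)) (a z : ZMod m) (h : Fin n → ZMod m) :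
    addressCount (Fin.insertNth j a h : Fin (n + 1) → ZMod m) z =
      (if a = z then 1 else 0) + addressCount h z := by
  rw [addressCount_eq_sum, addressCount_eq_sum, Fin.sum_univ_succAbove _ j]
  simp

/-- Marking one of the keys in the bucket `c k₀` and removing it. -/
lemma mul_windowCard_succ [NeZero m] {N : ℕ} {c : Fin N → ZMod m} (hc : Function.Injective c)
    (x : Fin N → ℕ) (k₀ : Fin N) :
    (x k₀ + 1) * windowCard (n + 1) c (x + Pi.single k₀ 1) = (n + 1) * windowCard n c x := by
  have h1 : ∑ h ∈ Finset.univ.filter fun h : Fin (n + 1) → ZMod m =>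
      ∀ k, addressCount h (c k) = (x + Pi.single k₀ 1 : Fin N → ℕ) k, addressCount h (c k₀) =
      (x k₀ + 1) * windowCard (n + 1) c (x + Pi.single k₀ 1) := by
    rw [windowCard, mul_comm, ← smul_eq_mul, ← Finset.sum_const]
    refine Finset.sum_congr rfl fun h hh => ?_
    rw [(Finset.mem_filter.1 hh).2 k₀]
    simp
  rw [← h1]
  simp only [addressCount_eq_sum _ (c k₀)]
  rw [Finset.sum_comm]
  have h2 : ∀ j : Fin (n + 1), (∑ h ∈ Finset.univ.filter fun h : Fin (n + 1) → ZMod m =>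
      ∀ k, addressCount h (c k) = (x + Pi.single k₀ 1 : Fin N → ℕ) k,
      if h j = c k₀ then 1 else 0) = windowCard n c x := by
    intro j
    rw [← Finset.card_filter, windowCard]
    symm
    refine Finset.card_bij (fun h _ => Fin.insertNth j (c k₀) h) ?_ ?_ ?_
    · intro h hh
      simp only [Finset.mem_filter, Finset.mem_univ, true_and] at hh ⊢
      refine ⟨fun k => ?_, by simp⟩
      rw [addressCount_insertNth, hh k, Pi.add_apply, Pi.single_apply, add_comm]
      congr 1
      simp only [hc.eq_iff, eq_comm]
    · intro h _ h' _ e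
      exact (Fin.insertNth_injective2 e).2
    · intro h hh
      simp only [Finset.mem_filter, Finset.mem_univ, true_and] at hh
      refine ⟨j.removeNth h, ?_, ?_⟩
      · simp only [Finset.mem_filter, Finset.mem_univ, true_and]
        intro k
        have h3 := hh.1 k
        rw [← Fin.insertNth_self_removeNth j h, addressCount_insertNth, hh.2, Pi.add_apply,
          Pi.single_apply] at h3
        simp only [hc.eq_iff, eq_comm (a := k₀)] at h3
        omega
      · rw [← hh.2, Fin.insertNth_self_removeNth]
  rw [Finset.sum_congr rfl fun j _ => h2 j]
  simp

end Exact

/-- Squeeze by `1 - 1 / x ≤ log x` and `x ≤ e ^ (x - 1)` at `x = 1 - N / m`. -/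
lemma tendsto_one_sub_div_pow {m n : ℕ → ℕ} (hm : Tendsto m atTop atTop) {a : ℝ}
    (ha : Tendsto (fun k => (n k : ℝ) / m k) atTop (𝓝 a)) (N : ℕ) :
    Tendsto (fun k => (1 - (N : ℝ) / m k) ^ n k) atTop (𝓝 (Real.exp (-(N * a)))) := by
  have hm' : Tendsto (fun k => (m k : ℝ)) atTop atTop := tendsto_natCast_atTop_atTop.comp hm
  have h0 : Tendsto (fun k => 1 - (N : ℝ) / m k) atTop (𝓝 1) := by
    simpa using (hm'.const_div_atTop (N : ℝ)).const_sub 1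
  have hpos : ∀ᶠ k in atTop, 0 < 1 - (N : ℝ) / m k := h0.eventually_const_lt zero_lt_one
  have hup : Tendsto (fun k => Real.exp (-(N * ((n k : ℝ) / m k)))) atTop
      (𝓝 (Real.exp (-(N * a)))) :=
    (Real.continuous_exp.tendsto _).comp (ha.const_mul (N : ℝ)).neg
  have hlo : Tendsto (fun k => Real.exp (-(N * ((n k : ℝ) / m k)) / (1 - (N : ℝ) / m k))) atTop
      (𝓝 (Real.exp (-(N * a)))) := by
    have := ((ha.const_mul (N : ℝ)).neg.div h0 one_ne_zero)
    rw [div_one] at this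
    exact (Real.continuous_exp.tendsto _).comp this
  refine tendsto_of_tendsto_of_tendsto_of_le_of_le' hlo hup ?_ ?_
  · filter_upwards [hpos] with k hk
    have h1 := Real.one_sub_inv_le_log_of_pos hk
    have h2 : -(N * ((n k : ℝ) / m k)) / (1 - (N : ℝ) / m k) =
        n k * (1 - (1 - (N : ℝ) / m k)⁻¹) := by
      field_simp
      ring
    rw [h2, Real.exp_nat_mul]
    refine pow_le_pow_left₀ (Real.exp_pos _).le ?_ _
    calc _ ≤ Real.exp (Real.log (1 - (N : ℝ) / m k)) := Real.exp_le_exp.2 h1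
      _ = _ := Real.exp_log hk
  · filter_upwards [hpos] with k hk
    have h2 : -(N * ((n k : ℝ) / m k)) = n k * (-(N / m k)) := by ring
    rw [h2, Real.exp_nat_mul]
    refine pow_le_pow_left₀ hk.le ?_ _
    have := Real.add_one_le_exp (-((N : ℝ) / m k))
    linarith

/-- The probabilities of windows under independent Poisson variables. -/
noncomputable def poissonWindow (a : ℝ) {N : ℕ} (x : Fin N → ℕ) : ℝ :=
  ∏ k, Real.exp (-a) * a ^ x k / (x k).factorial

/-- The limiting form of the recursion `mul_windowCard_succ`, in which the ratio is `n / (m * (x k₀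
+ 1))`. -/
lemma poissonWindow_add_single (a : ℝ) {N : ℕ} (x : Fin N → ℕ) (k₀ : Fin N) :
    poissonWindow a (x + Pi.single k₀ 1) = a / (x k₀ + 1) * poissonWindow a x := by
  unfold poissonWindow
  rw [← Finset.mul_prod_erase _ _ (Finset.mem_univ k₀), ← Finset.mul_prod_erase _ (fun k =>
    Real.exp (-a) * a ^ x k / (x k).factorial) (Finset.mem_univ k₀)]
  have h1 : ∏ k ∈ Finset.univ.erase k₀, Real.exp (-a) * a ^ (x + Pi.single k₀ 1 : Fin N → ℕ) k /
      ((x + Pi.single k₀ 1 : Fin N → ℕ) k).factorial =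
      ∏ k ∈ Finset.univ.erase k₀, Real.exp (-a) * a ^ x k / (x k).factorial := by
    refine Finset.prod_congr rfl fun k hk => ?_
    simp [(Finset.mem_erase.1 hk).1]
  rw [h1, ← mul_assoc]
  congr 1
  simp only [Pi.add_apply, Pi.single_eq_same, Nat.factorial_succ]
  push_cast
  rw [pow_succ]
  field_simp

lemma sub_natCast_injective {m N : ℕ} (h : N ≤ m) (i : ZMod m) :
    Function.Injective fun k : Fin N => i - ((k : ℕ) : ZMod m) := by
  intro x y hxy
  refine Fin.ext (zmod_add_natCast_inj (a := (0 : ZMod m)) (by omega) (by omega) ?_)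
  simpa using hxy

/-- Induction on the number `S` of keys in the window: deleting one of them replaces `n` by `n - 1`,
so the sequence `n` has to vary in the induction. The empty window is `(1 - N / m) ^ n`. -/
lemma tendsto_windowCard {N : ℕ} {a : ℝ} (S : ℕ) (x : Fin N → ℕ) (hx : ∑ k, x k = S)
    {m n : ℕ → ℕ} [∀ k, NeZero (m k)] (hm : Tendsto m atTop atTop) (hn : Tendsto n atTop atTop)
    (ha : Tendsto (fun k => (n k : ℝ) / m k) atTop (𝓝 a)) (i : ℤ) :
    Tendsto (fun k => (windowCard (n k) (fun j : Fin N => (i : ZMod (m k)) - ((j : ℕ) : ZMod (m k))) x : ℝ)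
      / (m k : ℝ) ^ n k) atTop (𝓝 (poissonWindow a x)) := by
  induction S generalizing x n with
  | zero =>
    have hx0 : x = 0 := by
      ext k
      exact (Finset.sum_eq_zero_iff.1 hx) k (Finset.mem_univ k)
    subst hx0
    have h1 : poissonWindow a (0 : Fin N → ℕ) = Real.exp (-(N * a)) := by
      simp [poissonWindow, ← Real.exp_nat_mul]
    rw [h1]
    refine (tendsto_one_sub_div_pow hm ha N).congr' ?_
    filter_upwards [hm.eventually_ge_atTop N] with k hk
    have hmk : (0 : ℝ) < m k := by exact_mod_cast Nat.pos_of_ne_zero (NeZero.ne (m k))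
    rw [windowCard_zero _ (sub_natCast_injective hk _)]
    push_cast [Nat.cast_sub hk]
    rw [← div_pow]
    congr 1
    field_simp
  | succ S ih =>
    obtain ⟨k₀, hk₀⟩ : ∃ k₀, 0 < x k₀ := by
      by_contra! hc
      have : ∑ k, x k = 0 := Finset.sum_eq_zero fun k _ => by have := hc k; omega
      omega
    obtain ⟨y, hy⟩ : ∃ y : Fin N → ℕ, x = y + Pi.single k₀ 1 := by
      refine ⟨x - Pi.single k₀ 1, ?_⟩
      ext k
      by_cases h : k = k₀
      · subst h; simp; omega
      · simp [h]
    subst hy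
    have hyS : ∑ k, y k = S := by
      simp only [Pi.add_apply, Finset.sum_add_distrib, Finset.sum_pi_single', Finset.mem_univ,
        if_true] at hx
      omega
    have hm' : Tendsto (fun k => (m k : ℝ)) atTop atTop := tendsto_natCast_atTop_atTop.comp hm
    have hn' : Tendsto (fun k => n k - 1) atTop atTop := by
      rw [tendsto_atTop] at hn ⊢
      intro c
      filter_upwards [hn (c + 1)] with k hk
      omega
    have ha' : Tendsto (fun k => ((n k - 1 : ℕ) : ℝ) / m k) atTop (𝓝 a) := by
      have := ha.sub (hm'.const_div_atTop (1 : ℝ))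
      rw [sub_zero] at this
      refine this.congr' ?_
      filter_upwards [hn.eventually_ge_atTop 1] with k hk
      push_cast [Nat.cast_sub hk]
      ring
    have h1 := (ha.div_const ((y k₀ : ℝ) + 1)).mul (ih y hyS hn' ha')
    rw [poissonWindow_add_single]
    refine h1.congr' ?_
    filter_upwards [hn.eventually_ge_atTop 1, hm.eventually_ge_atTop N] with k hk hmN
    have hmk : (0 : ℝ) < m k := by exact_mod_cast Nat.pos_of_ne_zero (NeZero.ne (m k))
    have h2 := mul_windowCard_succ (n := n k - 1) (sub_natCast_injective hmN (i : ZMod (m k))) y k₀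
    rw [Nat.sub_add_cancel hk] at h2
    have h3 : ((y k₀ : ℝ) + 1) * windowCard (n k)
        (fun j : Fin N => (i : ZMod (m k)) - ((j : ℕ) : ZMod (m k))) (y + Pi.single k₀ 1) =
        n k * windowCard (n k - 1)
        (fun j : Fin N => (i : ZMod (m k)) - ((j : ℕ) : ZMod (m k))) y := by exact_mod_cast h2
    have h4 : (m k : ℝ) ^ n k = m k * (m k : ℝ) ^ (n k - 1) := by
      rw [← pow_succ', Nat.sub_add_cancel hk]
    rw [h4]
    field_simp
    linarith

lemma tendsto_exactModel_window {N : ℕ} {a : ℝ} (x : Fin N → ℕ)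
    {m n : ℕ → ℕ} [∀ k, NeZero (m k)] (hm : Tendsto m atTop atTop) (hn : Tendsto n atTop atTop)
    (ha : Tendsto (fun k => (n k : ℝ) / m k) atTop (𝓝 a)) (i : ℤ) :
    Tendsto (fun k => (exactModel (m k) (n k)).real
      {h | ∀ j : Fin N, backward (fun k : ℤ => addressCount h k) i j = x j}) atTop
      (𝓝 (poissonWindow a x)) := by
  classical
  refine (tendsto_windowCard _ x rfl hm hn ha i).congr fun k => ?_
  rw [exactModel_real_eq, windowCard]
  simp [backward]

/-! ### The infinite Poisson model -/

section Poisson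

open scoped ENNReal

lemma lintegral_poissonMeasure_zpow {a r : ℝ} (ha : 0 ≤ a) (hr : 0 < r) (b : ℕ) :
    ∫⁻ x, ENNReal.ofReal (r ^ ((x : ℤ) - b)) ∂poissonMeasure a.toNNReal =
      ENNReal.ofReal (Real.exp ((r - 1) * a) / r ^ b) := by
  have h1 : HasSum (fun n : ℕ => Real.exp (-a) * a ^ n / n.factorial * r ^ ((n : ℤ) - b))
      (Real.exp ((r - 1) * a) / r ^ b) := by
    have h := (NormedSpace.expSeries_div_hasSum_exp (a * r)).mul_left (Real.exp (-a) / r ^ b)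
    rw [← Real.exp_eq_exp_ℝ] at h
    convert! h using 1
    · ext n
      rw [zpow_sub₀ hr.ne', mul_pow]
      simp only [zpow_natCast]
      field_simp
    · rw [div_mul_eq_mul_div, ← Real.exp_add]
      ring_nf
  rw [lintegral_countable']
  simp only [poissonMeasure_singleton, Real.coe_toNNReal a ha]
  rw [← h1.tsum_eq, ENNReal.ofReal_tsum_of_nonneg (fun n => by positivity) h1.summable]
  refine tsum_congr fun n => ?_
  rw [← ENNReal.ofReal_mul (by positivity), mul_comm]

lemma integral_pow_poissonMeasure {a : ℝ} (ha : 0 ≤ a) (q : ℂ) :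
    ∫ n : ℕ, q ^ n ∂poissonMeasure a.toNNReal = Complex.exp (a * (q - 1)) := by
  rw [integral_poissonMeasure, Real.coe_toNNReal a ha]
  have h := (NormedSpace.expSeries_div_hasSum_exp ((a : ℂ) * q)).mul_left (Complex.exp (-a))
  rw [← Complex.exp_eq_exp_ℂ, ← Complex.exp_add] at h
  rw [show (a : ℂ) * (q - 1) = -a + a * q by ring, ← h.tsum_eq]
  refine tsum_congr fun n => ?_
  rw [Complex.real_smul, mul_pow]
  push_cast
  ring

variable {Ω : Type*} [MeasurableSpace Ω] {P : Measure Ω} {X : ℤ → Ω → ℕ} {a : ℝ} {b : ℕ}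

lemma measurable_drift (hX : ∀ k, Measurable (X k)) (b : ℕ) (i : ℤ) (l : ℕ) :
    Measurable fun ω => drift b (backward (fun k => X k ω) i) l := by
  unfold drift backward
  refine Finset.measurable_sum _ fun k _ => ?_
  exact (measurable_from_top (f := fun x : ℕ => (x : ℤ) - b)).comp (hX _)

lemma lintegral_drift (hX : ∀ k, Measurable (X k)) (hi : iIndepFun X P)
    (hl : ∀ k, P.map (X k) = poissonMeasure a.toNNReal) (ha : 0 ≤ a) {r : ℝ} (hr : 0 < r)
    (i : ℤ) (l : ℕ) :
    ∫⁻ ω, ENNReal.ofReal (r ^ drift b (backward (fun k => X k ω) i) l) ∂P =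
      ENNReal.ofReal (Real.exp ((r - 1) * a) / r ^ b) ^ l := by
  set f : ℕ → ℝ≥0∞ := fun x => ENNReal.ofReal (r ^ ((x : ℤ) - b)) with hf
  have hfm : Measurable f := measurable_from_top
  have h1 : ∀ ω, ENNReal.ofReal (r ^ drift b (backward (fun k => X k ω) i) l) =
      ∏ k ∈ Finset.range l, f (X (i - k) ω) := by
    intro ω
    rw [hf, ← ENNReal.ofReal_prod_of_nonneg fun k _ => by positivity]
    congr 1
    unfold drift backward
    induction l with
    | zero => simp
    | succ l ih => rw [Finset.sum_range_succ, Finset.prod_range_succ, zpow_add₀ hr.ne', ih]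
  simp only [h1]
  have hinj : Function.Injective fun k : ℕ => i - (k : ℤ) := fun x y h => by simpa using h
  have h2 := lintegral_prod_eq_prod_lintegral_of_indepFun (Finset.range l)
    (fun (k : ℕ) ω => f (X (i - k) ω)) ((hi.precomp hinj).comp (fun _ => f) fun _ => hfm)
    (fun k => hfm.comp (hX _))
  rw [h2, ← Finset.card_range l, ← Finset.prod_const, Finset.card_range]
  refine Finset.prod_congr rfl fun k _ => ?_
  rw [← lintegral_poissonMeasure_zpow ha hr b, ← hl (i - k), lintegral_map hfm (hX _)]

/-- The partial sums are almost surely bounded above. -/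
lemma ae_bddAbove_drift (hX : ∀ k, Measurable (X k)) (hi : iIndepFun X P)
    (hl : ∀ k, P.map (X k) = poissonMeasure a.toNNReal) (ha : 0 ≤ a) {r : ℝ} (hr : 1 < r)
    (hρ : Real.exp ((r - 1) * a) / r ^ b < 1) :
    ∀ᵐ ω ∂P, ∀ i, BddAbove (Set.range (drift b (backward (fun k => X k ω) i))) := by
  have hr0 : 0 < r := by linarith
  rw [ae_all_iff]
  intro i
  have hm : ∀ l, Measurable fun ω => ENNReal.ofReal (r ^ drift b (backward (fun k => X k ω) i) l) :=
    fun l => (measurable_from_top (f := fun z : ℤ => ENNReal.ofReal (r ^ z))).comp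
      (measurable_drift hX b i l)
  have h1 := lintegral_tsum_geometric_le (μ := P) (fun l => (hm l).aemeasurable)
    (fun l => (lintegral_drift hX hi hl ha hr0 i l).le) 0
  have h2 : ∫⁻ ω, ∑' l, ENNReal.ofReal (r ^ drift b (backward (fun k => X k ω) i) (0 + l)) ∂P ≠ ∞ := by
    refine ne_top_of_le_ne_top ?_ h1
    rw [pow_zero, one_mul, ENNReal.inv_ne_top]
    refine (tsub_pos_of_lt ?_).ne'
    rw [ENNReal.ofReal_lt_one]
    exact hρ
  -- The sum of the weights has finite expectation, so it is almost surely finite; it bounds every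
  -- single weight, hence every partial sum.
  filter_upwards [ae_lt_top (Measurable.tsum fun l => hm (0 + l)) h2] with ω hω
  obtain ⟨N, hN⟩ := pow_unbounded_of_one_lt
    (∑' l, ENNReal.ofReal (r ^ drift b (backward (fun k => X k ω) i) (0 + l))).toReal hr
  refine ⟨N, ?_⟩
  rintro _ ⟨l, rfl⟩
  have h3 := ENNReal.le_tsum
    (f := fun l => ENNReal.ofReal (r ^ drift b (backward (fun k => X k ω) i) (0 + l))) l
  have h4 := (ENNReal.ofReal_le_iff_le_toReal hω.ne).1 h3
  rw [zero_add] at h4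
  have h5 := h4.trans hN.le
  rw [← zpow_natCast] at h5
  exact (zpow_le_zpow_iff_right₀ hr).1 h5

lemma measureReal_window (hi : iIndepFun X P) (hX : ∀ k, Measurable (X k))
    (hl : ∀ k, P.map (X k) = poissonMeasure a.toNNReal) (ha : 0 ≤ a) {N : ℕ} (x : Fin N → ℕ)
    (i : ℤ) :
    P.real {ω | ∀ j : Fin N, backward (fun k => X k ω) i j = x j} = poissonWindow a x := by
  have hinj : Function.Injective fun k : Fin N => i - ((k : ℕ) : ℤ) := fun x y h => by
    simpa [Fin.ext_iff] using h
  have h1 := (hi.precomp hinj).meas_iInter (s := fun k : Fin N => X (i - ((k : ℕ) : ℤ)) ⁻¹' {x k})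
    fun k => ⟨{x k}, measurableSet_singleton _, rfl⟩
  have h2 : {ω | ∀ j : Fin N, backward (fun k => X k ω) i j = x j} =
      ⋂ k : Fin N, X (i - ((k : ℕ) : ℤ)) ⁻¹' {x k} := by
    ext ω
    simp [backward]
  rw [h2, measureReal_def, h1, ENNReal.toReal_prod, poissonWindow]
  refine Finset.prod_congr rfl fun k _ => ?_
  rw [← Measure.map_apply (hX _) (measurableSet_singleton _), hl, ← measureReal_def,
    poissonMeasure_real_singleton, Real.coe_toNNReal a ha]

lemma measurable_iSup_int {Ω' : Type*} {m : MeasurableSpace Ω'} {f : ℕ → Ω' → ℤ}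
    (hf : ∀ l, Measurable (f l)) : Measurable fun ω => ⨆ l, f l ω := Measurable.iSup hf

/-- Measurability with respect to the variables up to `i` alone is what makes the overflow
independent of the next `X`. -/
lemma measurable_overflowZ_comap {Ω : Type*} (X : ℤ → Ω → ℕ) (b : ℕ) (i : ℤ) :
    Measurable[⨆ k ∈ Set.Iic i, MeasurableSpace.comap (X k) inferInstance]
      fun ω => overflowZ b (fun k => X k ω) i := by
  unfold overflowZ
  simp only [iSup_Iic_eq_iSup_drift]
  refine (measurable_from_top (f := Int.toNat)).comp (measurable_iSup_int fun l => ?_)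
  unfold drift backward
  refine Finset.measurable_sum _ fun k _ => ?_
  refine (measurable_from_top (f := fun x : ℕ => (x : ℤ) - b)).comp ?_
  refine Measurable.mono (comap_measurable (X (i - k))) ?_ le_rfl
  exact le_iSup₂_of_le (i - k) (by simp) le_rfl

lemma measurable_overflowZ (hX : ∀ k, Measurable (X k)) (b : ℕ) (i : ℤ) :
    Measurable fun ω => overflowZ b (fun k => X k ω) i :=
  (measurable_overflowZ_comap X b i).mono (iSup₂_le fun k _ => (hX k).comap_le) le_rfl

lemma indepFun_overflowZ (hi : iIndepFun X P) (hX : ∀ k, Measurable (X k)) (b : ℕ) (i : ℤ) :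
    IndepFun (X i) (fun ω => overflowZ b (fun k => X k ω) (i - 1)) P := by
  have h := indep_iSup_of_disjoint (fun k => (hX k).comap_le) hi.iIndep
    (S := {i}) (T := Set.Iic (i - 1)) (by simp)
  rw [IndepFun_iff_Indep]
  refine indep_of_indep_of_le_left (indep_of_indep_of_le_right h ?_) ?_
  · exact (measurable_overflowZ_comap X b (i - 1)).comap_le
  · simp

/-- The generating functions of the profile and the overflow from the preceding bucket. -/
lemma pgf_profileZ (hX : ∀ k, Measurable (X k)) (hi : iIndepFun X P)
    (hl : ∀ k, P.map (X k) = poissonMeasure a.toNNReal) (ha : 0 ≤ a) (i : ℤ) (q : ℂ) :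
    pgf P (fun ω => profileZ b (fun k => X k ω) i) q =
      Complex.exp (a * (q - 1)) * pgf P (fun ω => overflowZ b (fun k => X k ω) (i - 1)) q := by
  have hq : Measurable fun n : ℕ => q ^ n := measurable_from_top
  have h := ((indepFun_overflowZ hi hX b i).comp hq hq).integral_mul_eq_mul_integral
    (hq.comp (hX i)).aestronglyMeasurable
    (hq.comp (measurable_overflowZ hX b (i - 1))).aestronglyMeasurable
  unfold pgf profileZ
  simp only [pow_add]
  refine h.trans ?_
  congr 1
  rw [← integral_pow_poissonMeasure ha, ← hl i, integral_map (hX i).aemeasurable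
    hq.aestronglyMeasurable]
  rfl

lemma measurable_profileZ (hX : ∀ k, Measurable (X k)) (b : ℕ) (i : ℤ) :
    Measurable fun ω => profileZ b (fun k => X k ω) i :=
  (hX i).add (measurable_overflowZ hX b (i - 1))

lemma ae_exists_drift (hX : ∀ k, Measurable (X k)) (hi : iIndepFun X P)
    (hl : ∀ k, P.map (X k) = poissonMeasure a.toNNReal) (ha : 0 ≤ a) {r : ℝ} (hr : 1 < r)
    (hρ : Real.exp ((r - 1) * a) / r ^ b < 1) (i : ℤ) :
    ∀ᵐ ω ∂P, ∃ l, drift b (backward (fun k => X k ω) i) l = overflowZ b (fun k => X k ω) i ∧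
      (∀ l', drift b (backward (fun k => X k ω) i) l' ≤ overflowZ b (fun k => X k ω) i) ∧
      ENNReal.ofReal (r ^ drift b (backward (fun k => X k ω) i) l) ≤
        ENNReal.ofReal (r ^ drift b (backward (fun k => X k ω) i) l) := by
  filter_upwards [ae_bddAbove_drift hX hi hl ha hr hρ] with ω hω
  obtain ⟨⟨l, hl⟩, h2⟩ := isGreatest_overflowZ (hω i)
  exact ⟨l, hl, fun l' => h2 ⟨l', rfl⟩, le_rfl⟩

lemma aemeasurable_drift_weight (hX : ∀ k, Measurable (X k)) (b : ℕ) (r : ℝ) (i : ℤ) (l : ℕ) :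
    AEMeasurable (fun ω => ENNReal.ofReal (r ^ drift b (backward (fun k => X k ω) i) l)) P :=
  ((measurable_from_top (f := fun z : ℤ => ENNReal.ofReal (r ^ z))).comp
    (measurable_drift hX b i l)).aemeasurable

lemma profileZ_tail [IsProbabilityMeasure P] (hX : ∀ k, Measurable (X k)) (hi : iIndepFun X P)
    (hl : ∀ k, P.map (X k) = poissonMeasure a.toNNReal) (ha : 0 ≤ a) {r ρ : ℝ} (hr : 1 < r)
    (hρ0 : Real.exp ((r - 1) * a) / r ^ b ≤ ρ) (hρ : ρ < 1) (i : ℤ) (j : ℕ) :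
    P.real ((fun ω => profileZ b (fun k => X k ω) i) ⁻¹' {j}) * r ^ j ≤ r ^ b / (1 - ρ) := by
  have hr0 : 0 < r := by linarith
  have h0 : 0 ≤ ρ := le_trans (by positivity) hρ0
  refine measureReal_mul_pow_le hr.le h0 hρ (aemeasurable_drift_weight hX b r i)
    (fun l => (lintegral_drift hX hi hl ha hr0 i l).trans_le (by gcongr))
    (ae_exists_drift hX hi hl ha hr (hρ0.trans_lt hρ) i) ?_ j
  filter_upwards [ae_bddAbove_drift hX hi hl ha hr (hρ0.trans_lt hρ)] with ω hω
  have := (hashingEquations_overflowZ hω i).2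
  omega

lemma abs_profileZ_sub_le [IsProbabilityMeasure P] (hX : ∀ k, Measurable (X k)) (hi : iIndepFun X P)
    (hl : ∀ k, P.map (X k) = poissonMeasure a.toNNReal) (ha : 0 ≤ a) {r ρ : ℝ} (hr : 1 < r)
    (hρ0 : Real.exp ((r - 1) * a) / r ^ b ≤ ρ) (hρ : ρ < 1) (i : ℤ) (j L : ℕ) :
    |P.real ((fun ω => profileZ b (fun k => X k ω) i) ⁻¹' {j}) -
      ∑ x ∈ windowSet b L j, poissonWindow a x| ≤ ρ ^ (L + 1) / (1 - ρ) := by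
  have hr0 : 0 < r := by linarith
  have h0 : 0 ≤ ρ := le_trans (by positivity) hρ0
  have h1 := measureReal_ne_truncOverflow_le hr.le h0 hρ (aemeasurable_drift_weight hX b r (i - 1))
    (fun l => (lintegral_drift hX hi hl ha hr0 (i - 1) l).trans_le (by gcongr))
    (ae_exists_drift hX hi hl ha hr (hρ0.trans_lt hρ) (i - 1)) L
  have h2 := abs_measureReal_sub_truncProfile_le (μ := P) (V := fun ω => backward (fun k => X k ω) i)
    (Q := fun ω => overflowZ b (fun k => X k ω) (i - 1))
    (H := fun ω => profileZ b (fun k => X k ω) i) (b := b) (L := L)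
    (Eventually.of_forall fun ω => by simp [profileZ, backward]) j
  have h3 : ∀ ω, (fun k => backward (fun k => X k ω) i (k + 1)) =
      backward (fun k => X k ω) (i - 1) := fun ω => by
    ext k
    simp only [backward]
    rw [show i - ((k + 1 : ℕ) : ℤ) = i - 1 - k by push_cast; ring]
  simp only [h3] at h2
  rw [measureReal_truncProfile (V := fun ω => backward (fun k => X k ω) i) (fun k => hX _)] at h2
  simp only [measureReal_window hi hX hl ha] at h2
  exact h2.trans h1

/-- The law of the profile is the limit of the truncated laws. -/
lemma tendsto_windowSum [IsProbabilityMeasure P] (hX : ∀ k, Measurable (X k)) (hi : iIndepFun X P)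
    (hl : ∀ k, P.map (X k) = poissonMeasure a.toNNReal) (ha : 0 ≤ a) {r ρ : ℝ} (hr : 1 < r)
    (hρ0 : Real.exp ((r - 1) * a) / r ^ b ≤ ρ) (hρ : ρ < 1) (i : ℤ) (j : ℕ) :
    Tendsto (fun L => ∑ x ∈ windowSet b L j, poissonWindow a x) atTop
      (𝓝 (P.real ((fun ω => profileZ b (fun k => X k ω) i) ⁻¹' {j}))) := by
  have hr0 : 0 < r := by linarith
  have h0 : 0 ≤ ρ := le_trans (by positivity) hρ0
  have h1 : Tendsto (fun L : ℕ => ρ ^ (L + 1) / (1 - ρ)) atTop (𝓝 0) := by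
    have := ((tendsto_pow_atTop_nhds_zero_of_lt_one h0 hρ).comp (tendsto_add_atTop_nat 1)).div_const
      (1 - ρ)
    simpa using this
  rw [tendsto_iff_dist_tendsto_zero]
  refine squeeze_zero (fun _ => dist_nonneg) (fun L => ?_) h1
  rw [dist_comm, Real.dist_eq]
  exact abs_profileZ_sub_le hX hi hl ha hr hρ0 hρ i j L

/-- The law of the profile does not depend on the position. -/
lemma map_profileZ_eq [IsProbabilityMeasure P] (hX : ∀ k, Measurable (X k)) (hi : iIndepFun X P)
    (hl : ∀ k, P.map (X k) = poissonMeasure a.toNNReal) (ha : 0 ≤ a) {r : ℝ} (hr : 1 < r)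
    (hρ : Real.exp ((r - 1) * a) / r ^ b < 1) (i i' : ℤ) :
    P.map (fun ω => profileZ b (fun k => X k ω) i) =
      P.map (fun ω => profileZ b (fun k => X k ω) i') := by
  refine Measure.ext_of_singleton fun j => ?_
  rw [Measure.map_apply (measurable_profileZ hX b i) (measurableSet_singleton _),
    Measure.map_apply (measurable_profileZ hX b i') (measurableSet_singleton _)]
  -- The approximating window sums do not involve the position.
  have h := tendsto_nhds_unique (tendsto_windowSum hX hi hl ha hr le_rfl hρ i j)
    (tendsto_windowSum hX hi hl ha hr le_rfl hρ i' j)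
  exact (ENNReal.toReal_eq_toReal_iff' (measure_ne_top _ _) (measure_ne_top _ _)).1 h

end Poisson

/-! ### Convergence of the laws in the exact model -/

section Convergence

variable {Ω : Type*} [MeasurableSpace Ω] {P : Measure Ω} [IsProbabilityMeasure P]
  {X : ℤ → Ω → ℕ} {a : ℝ} {b : ℕ}

/-- The moment bound needs windows without repeated buckets, so the weight is set to zero for `l ≥
m`; this is harmless because a maximiser exists below `m`. -/
lemma exists_weight_exactModel {m n b : ℕ} [NeZero m] (hn : n < b * m) {r a' ρ : ℝ} (hr : 1 ≤ r)
    (ha' : (n : ℝ) / m ≤ a') (hρ0 : Real.exp ((r - 1) * a') / r ^ b ≤ ρ) (i : ℤ) :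
    ∃ g : ℕ → (Fin n → ZMod m) → ENNReal, (∀ l, AEMeasurable (g l) (exactModel m n)) ∧
      (∀ l, ∫⁻ h, g l h ∂exactModel m n ≤ ENNReal.ofReal ρ ^ l) ∧
      ∀ᵐ h ∂exactModel m n, ∃ l, drift b (backward (fun k : ℤ => addressCount h k) i) l =
        overflowMN b m n i h ∧
        (∀ l', drift b (backward (fun k : ℤ => addressCount h k) i) l' ≤ overflowMN b m n i h) ∧
        ENNReal.ofReal (r ^ drift b (backward (fun k : ℤ => addressCount h k) i) l) ≤ g l h := by
  refine ⟨fun l h => if l < m then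
    ENNReal.ofReal (r ^ drift b (backward (fun k : ℤ => addressCount h k) i) l) else 0,
    fun l => (measurable_of_finite _).aemeasurable, fun l => ?_, Eventually.of_forall fun h => ?_⟩
  · by_cases hl : l < m
    · simp only [if_pos hl]
      refine (lintegral_exactModel_drift_le hl.le i hr ha').trans ?_
      gcongr
    · simp [hl]
  · obtain ⟨⟨l, hlm, hl⟩, h2⟩ := isGreatest_overflowMN h hn i
    exact ⟨l, hl, h2, by simp [hlm]⟩

lemma profileMN_tail {m n b : ℕ} [NeZero m] (hn : n < b * m) {r a' ρ : ℝ} (hr : 1 ≤ r)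
    (ha' : (n : ℝ) / m ≤ a') (hρ0 : Real.exp ((r - 1) * a') / r ^ b ≤ ρ) (hρ : ρ < 1) (i : ℤ)
    (j : ℕ) : (exactModel m n).real (profileMN b m n i ⁻¹' {j}) * r ^ j ≤ r ^ b / (1 - ρ) := by
  have hr0 : 0 < r := by linarith
  have h0 : 0 ≤ ρ := le_trans (by positivity) hρ0
  obtain ⟨g, hg, hgρ, hgQ⟩ := exists_weight_exactModel hn hr ha' hρ0 i
  refine measureReal_mul_pow_le hr h0 hρ hg hgρ hgQ (Eventually.of_forall fun h => ?_) j
  have := (hashingEquations_finalTable h hn.le i).2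
  simp only at this
  omega

lemma abs_profileMN_sub_le {m n b : ℕ} [NeZero m] (hn : n < b * m) {r a' ρ : ℝ} (hr : 1 ≤ r)
    (ha' : (n : ℝ) / m ≤ a') (hρ0 : Real.exp ((r - 1) * a') / r ^ b ≤ ρ) (hρ : ρ < 1) (i : ℤ)
    (j L : ℕ) :
    |(exactModel m n).real (profileMN b m n i ⁻¹' {j}) - ∑ x ∈ windowSet b L j,
      (exactModel m n).real {h | ∀ k : Fin (L + 1),
        backward (fun k : ℤ => addressCount h k) i k = x k}| ≤ ρ ^ (L + 1) / (1 - ρ) := by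
  have hr0 : 0 < r := by linarith
  have h0 : 0 ≤ ρ := le_trans (by positivity) hρ0
  obtain ⟨g, hg, hgρ, hgQ⟩ := exists_weight_exactModel hn hr ha' hρ0 (i - 1)
  have h1 := measureReal_ne_truncOverflow_le hr h0 hρ hg hgρ hgQ L
  have h2 := abs_measureReal_sub_truncProfile_le (μ := exactModel m n)
    (V := fun h => backward (fun k : ℤ => addressCount h k) i)
    (Q := overflowMN b m n (i - 1)) (H := profileMN b m n i) (b := b) (L := L)
    (Eventually.of_forall fun h => by
      have := (hashingEquations_finalTable h hn.le i).1
      simpa [backward] using this) j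
  have h3 : ∀ h : Fin n → ZMod m, (fun k => backward (fun k : ℤ => addressCount h k) i (k + 1)) =
      backward (fun k : ℤ => addressCount h k) (i - 1) := fun h => by
    ext k
    simp only [backward]
    rw [show i - ((k + 1 : ℕ) : ℤ) = i - 1 - k by push_cast; ring]
  simp only [h3] at h2
  rw [measureReal_truncProfile (fun k => measurable_of_finite _)] at h2
  exact h2.trans h1

/-- Pointwise convergence of the law of the profile. -/
lemma tendsto_measureReal_profileMN (hX : ∀ k, Measurable (X k)) (hi : iIndepFun X P)
    (hl : ∀ k, P.map (X k) = poissonMeasure a.toNNReal) (ha : 0 ≤ a) {r ρ a' : ℝ} (hr : 1 < r)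
    (haa' : a < a') (ha'b : a' < b) (hρ0 : Real.exp ((r - 1) * a') / r ^ b ≤ ρ) (hρ : ρ < 1)
    {m n : ℕ → ℕ} [∀ k, NeZero (m k)] (hm : Tendsto m atTop atTop) (hn : Tendsto n atTop atTop)
    (hmn : Tendsto (fun k => (n k : ℝ) / m k) atTop (𝓝 a)) (i : ℤ) (j : ℕ) :
    Tendsto (fun k => (exactModel (m k) (n k)).real (profileMN b (m k) (n k) i ⁻¹' {j})) atTop
      (𝓝 (P.real ((fun ω => profileZ b (fun k => X k ω) i) ⁻¹' {j}))) := by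
  have hr0 : 0 < r := by linarith
  have h0 : 0 ≤ ρ := le_trans (by positivity) hρ0
  have hρ0' : Real.exp ((r - 1) * a) / r ^ b ≤ ρ := by
    refine le_trans ?_ hρ0
    have : 0 ≤ r - 1 := by linarith
    gcongr
  have h1 : Tendsto (fun L : ℕ => ρ ^ (L + 1) / (1 - ρ)) atTop (𝓝 0) := by
    have := ((tendsto_pow_atTop_nhds_zero_of_lt_one h0 hρ).comp (tendsto_add_atTop_nat 1)).div_const
      (1 - ρ)
    simpa using this
  rw [Metric.tendsto_atTop']
  intro ε hε
  -- One third of `ε` for truncation in each of the two models, one third for the convergence of the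
  -- finitely many windows of length `L + 1`.
  obtain ⟨L, hL⟩ := (h1.eventually_lt_const (show 0 < ε / 3 by positivity)).exists
  have hsum : Tendsto (fun k => ∑ x ∈ windowSet b L j, (exactModel (m k) (n k)).real
      {h | ∀ k' : Fin (L + 1), backward (fun k : ℤ => addressCount h k) i k' = x k'}) atTop
      (𝓝 (∑ x ∈ windowSet b L j, poissonWindow a x)) :=
    tendsto_finsetSum _ fun x _ => tendsto_exactModel_window x hm hn hmn i
  have hev := (Metric.tendsto_nhds.1 hsum) (ε / 3) (by positivity)
  have hfin := (hmn.eventually_lt_const haa').and hev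
  obtain ⟨N, hN⟩ := eventually_atTop.1 hfin
  refine ⟨N, fun k hk => ?_⟩
  obtain ⟨h3, h4⟩ := hN k hk.le
  have hmk : (0 : ℝ) < m k := by exact_mod_cast Nat.pos_of_ne_zero (NeZero.ne (m k))
  have hnb : n k < b * m k := by
    have : (n k : ℝ) < b * m k := by
      rw [← div_lt_iff₀ hmk]
      exact h3.trans ha'b
    exact_mod_cast this
  have h5 := abs_profileMN_sub_le hnb hr.le h3.le hρ0 hρ i j L
  have h6 := abs_profileZ_sub_le hX hi hl ha hr hρ0' hρ i j L
  rw [Real.dist_eq] at h4 ⊢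
  rw [abs_lt] at h4 ⊢
  rw [abs_le] at h5 h6
  constructor <;> linarith [h5.1, h5.2, h6.1, h6.2, h4.1, h4.2]

end Convergence

/-! ### Identification of the generating functions -/

/-- The normal form at `z` depends only on the punctured germ, and an analytic function is its own
normal form. -/
lemma toMeromorphicNFOn_eq_of_analyticAt {f g : ℂ → ℂ} (hf : MeromorphicOn f Set.univ) {z : ℂ}
    (hg : AnalyticAt ℂ g z) (h : f =ᶠ[𝓝[≠] z] g) : toMeromorphicNFOn f Set.univ z = g z := by
  rw [toMeromorphicNFOn_eq_toMeromorphicNFAt hf (Set.mem_univ z),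
    (toMeromorphicNFAt_eventuallyEq_nhds_congr h).eq_of_nhds,
    toMeromorphicNFAt_eq_self.2 hg.meromorphicNFAt]

lemma meromorphicOn_profileFormula (b : ℕ) (α : ℝ) :
    MeromorphicOn (profileFormula b α) Set.univ := by
  intro z _
  unfold profileFormula
  refine MeromorphicAt.mul (MeromorphicAt.div ?_ ?_) (MeromorphicAt.div ?_ ?_) <;>
  exact AnalyticAt.meromorphicAt (by fun_prop)

lemma meromorphicOn_overflowFormula (b : ℕ) (α : ℝ) :
    MeromorphicOn (overflowFormula b α) Set.univ := by
  intro z _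
  unfold overflowFormula
  refine MeromorphicAt.mul (MeromorphicAt.div ?_ ?_) (MeromorphicAt.div ?_ ?_) <;>
  exact AnalyticAt.meromorphicAt (by fun_prop)

/-- The denominator of the overflow formula. -/
noncomputable def overflowDenom (b : ℕ) (α : ℝ) (q : ℂ) : ℂ := q ^ b - Complex.exp (α * b * (q - 1))

lemma eventually_overflowDenom_ne_zero {b : ℕ} (hb : 1 ≤ b) (α : ℝ) (z : ℂ) :
    ∀ᶠ q in 𝓝[≠] z, overflowDenom b α q ≠ 0 := by
  have han : AnalyticOnNhd ℂ (overflowDenom b α) Set.univ := fun w _ => by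
    unfold overflowDenom; fun_prop
  refine (han z (Set.mem_univ z)).eventually_eq_zero_or_eventually_ne_zero.resolve_left fun h => ?_
  -- If the denominator vanished near `z`, it would vanish at `0`, where it equals `-e^(-αb)`
  -- because `b ≥ 1`.
  have h0 := han.eqOn_zero_of_preconnected_of_eventuallyEq_zero isPreconnected_univ
    (Set.mem_univ z) h (Set.mem_univ 0)
  simp only [overflowDenom, zero_pow (show b ≠ 0 by omega), zero_sub, Pi.zero_apply, neg_eq_zero]
    at h0
  exact Complex.exp_ne_zero _ h0

/-- The denominators differ by an exponential factor, so the identity also holds at their zeros,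
where both quotients take the default value `0`. -/
lemma profileFormula_eq (b : ℕ) (α : ℝ) (q : ℂ) :
    profileFormula b α q = Complex.exp (α * b * (q - 1)) * overflowFormula b α q := by
  have h : q ^ b * Complex.exp (α * b * (1 - q)) - 1 =
      (Complex.exp (α * b * (q - 1)))⁻¹ * (q ^ b - Complex.exp (α * b * (q - 1))) := by
    rw [mul_sub (Complex.exp _)⁻¹, inv_mul_cancel₀ (Complex.exp_ne_zero _), ← Complex.exp_neg, mul_comm]
    ring_nf
  unfold profileFormula overflowFormula
  rw [h, ← div_div, div_inv_eq_mul]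
  ring

section GeneratingFunctions

variable {ν : Measure ℕ} [IsFiniteMeasure ν] {r C : ℝ}

/-- The generating function of the overflow in terms of the law of the profile. -/
noncomputable def overflowPgf (ν : Measure ℕ) (b : ℕ) (q : ℂ) : ℂ := ∫ j, q ^ (j - b) ∂ν

lemma norm_pow_sub_le {s : ℝ} (hs : 1 ≤ s) {q : ℂ} (hq : ‖q‖ ≤ s) (b j : ℕ) :
    ‖q ^ (j - b)‖ ≤ 1 * s ^ j := by
  rw [norm_pow, one_mul]
  exact (pow_le_pow_left₀ (norm_nonneg _) hq _).trans (pow_le_pow_right₀ hs (Nat.sub_le _ _))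

lemma hasSum_overflowPgf (hr : 1 < r) (hC : ∀ j, ν.real {j} * r ^ j ≤ C) (b : ℕ) {q : ℂ}
    (hq : ‖q‖ < r) : HasSum (fun j => ν.real {j} • q ^ (j - b)) (overflowPgf ν b q) :=
  hasSum_integral_of_tail (s := max 1 ‖q‖) (by positivity) (max_lt hr hq) hC
    (norm_pow_sub_le (le_max_left _ _) (le_max_right _ _) b)

lemma analyticAt_overflowPgf (hr : 1 < r) (hC : ∀ j, ν.real {j} * r ^ j ≤ C) (b : ℕ) {q : ℂ}
    (hq : ‖q‖ < r) : AnalyticAt ℂ (overflowPgf ν b) q := by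
  obtain ⟨s, hs1, hsr⟩ := exists_between (max_lt hr hq)
  have h1s : 1 ≤ s := (le_max_left _ _).trans hs1.le
  have hd : DifferentiableOn ℂ (fun w : ℂ => ∑' j, ν.real {j} • w ^ (j - b)) (Metric.ball 0 s) := by
    refine Complex.differentiableOn_tsum_of_summable_norm
      (summable_geometric_tail (by positivity) hsr hC) (fun j => ?_) Metric.isOpen_ball ?_
    · exact (by fun_prop : Differentiable ℂ fun w : ℂ => ν.real {j} • w ^ (j - b)).differentiableOn
    · intro j w hw
      have hw' : ‖w‖ ≤ s := by simpa using (Metric.mem_ball.1 hw).le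
      rw [norm_smul, Real.norm_of_nonneg measureReal_nonneg]
      have := norm_pow_sub_le h1s hw' b j
      rw [one_mul] at this
      gcongr
  have hmem : Metric.ball (0 : ℂ) s ∈ 𝓝 q :=
    Metric.isOpen_ball.mem_nhds (by simpa using (le_max_right _ _).trans_lt hs1)
  refine (hd.analyticAt hmem).congr ?_
  filter_upwards [hmem] with w hw
  have hw' : ‖w‖ < s := by simpa using hw
  exact (hasSum_overflowPgf hr hC b (hw'.trans hsr)).tsum_eq

/-- The polynomial `∑_{j < b} P(H = j) (q^b - q^j)`. -/
noncomputable def deficitPoly (ν : Measure ℕ) (b : ℕ) : Polynomial ℂ :=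
  ∑ j ∈ Finset.range b, Polynomial.C (ν.real {j} : ℂ) * (Polynomial.X ^ b - Polynomial.X ^ j)

/-- For `j ≥ b` the contributions `q ^ b * q ^ (j - b)` and `q ^ j` cancel; only the outcomes
without overflow, `j < b`, remain. -/
lemma eval_deficitPoly (hr : 1 < r) (hC : ∀ j, ν.real {j} * r ^ j ≤ C) (b : ℕ) {q : ℂ}
    (hq : ‖q‖ < r) :
    (deficitPoly ν b).eval q = q ^ b * overflowPgf ν b q - ∫ j, q ^ j ∂ν := by
  have h1 := (hasSum_overflowPgf hr hC b hq).mul_left (q ^ b)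
  have h2 := hasSum_overflowPgf hr hC 0 hq
  have h3 := h1.sub h2
  have h4 : HasSum (fun j => q ^ b * ν.real {j} • q ^ (j - b) - ν.real {j} • q ^ (j - 0))
      (∑ j ∈ Finset.range b, (q ^ b * ν.real {j} • q ^ (j - b) - ν.real {j} • q ^ (j - 0))) := by
    refine hasSum_sum_of_ne_finset_zero fun j hj => ?_
    have hj' : b ≤ j := by simpa using hj
    rw [mul_smul_comm, ← pow_add, Nat.add_sub_cancel' hj', Nat.sub_zero, sub_self]
  have h5 := h3.unique h4
  simp only [overflowPgf, Nat.sub_zero] at h5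
  rw [overflowPgf, h5, deficitPoly, Polynomial.eval_finsetSum]
  refine Finset.sum_congr rfl fun j hj => ?_
  have hj' := Finset.mem_range.1 hj
  simp only [Polynomial.eval_mul, Polynomial.eval_C, Polynomial.eval_sub, Polynomial.eval_pow,
    Polynomial.eval_X, Complex.real_smul, Nat.sub_eq_zero_of_le hj'.le, pow_zero]
  ring

/-- The degree is at most `b`. Subtracting the right multiple of the monic product lowers it below
`b`, while `b` distinct zeros remain. -/
lemma exists_deficitPoly_eq {ν : Measure ℕ} {b : ℕ} {z : ℕ → ℂ} (hz : Set.InjOn z (Finset.range b))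
    (h0 : ∀ l < b, (deficitPoly ν b).eval (z l) = 0) :
    ∃ c : ℂ, ∀ q, (deficitPoly ν b).eval q = c * ∏ l ∈ Finset.range b, (q - z l) := by
  set p := deficitPoly ν b with hp
  set R : Polynomial ℂ := ∏ l ∈ Finset.range b, (Polynomial.X - Polynomial.C (z l)) with hR
  have hRm : R.Monic := Polynomial.monic_prod_of_monic _ _ fun l _ => Polynomial.monic_X_sub_C _
  have hRd : R.natDegree = b := by
    rw [hR, Polynomial.natDegree_prod_of_monic _ _ fun l _ => Polynomial.monic_X_sub_C _]
    simp
  have hpd : p.degree ≤ b := by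
    refine (Polynomial.degree_sum_le _ _).trans (Finset.sup_le fun j hj => ?_)
    have hj' := Finset.mem_range.1 hj
    refine (Polynomial.degree_mul_le_of_le Polynomial.degree_C_le (Polynomial.degree_sub_le _ _)).trans ?_
    simp only [Polynomial.degree_X_pow, zero_add, sup_le_iff, le_refl, true_and, Nat.cast_le]
    exact hj'.le
  refine ⟨p.coeff b, fun q => ?_⟩
  have hdiff : p - Polynomial.C (p.coeff b) * R = 0 := by
    refine Polynomial.eq_zero_of_degree_lt_of_eval_index_eq_zero (Finset.range b) hz ?_ ?_
    · rw [Finset.card_range, Polynomial.degree_lt_iff_coeff_zero]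
      intro k hk
      have hRk : R.coeff b = 1 := by rw [← hRd]; exact hRm
      rcases hk.eq_or_lt with rfl | hk
      · simp [hRk]
      · rw [Polynomial.coeff_sub, Polynomial.coeff_C_mul, Polynomial.coeff_eq_zero_of_degree_lt
          (hpd.trans_lt (by exact_mod_cast hk)), Polynomial.coeff_eq_zero_of_natDegree_lt (p := R)
          (by rw [hRd]; exact hk)]
        simp
    · intro l hl
      have hl' := Finset.mem_range.1 hl
      rw [Polynomial.eval_sub, h0 l hl', Polynomial.eval_mul, hR, Polynomial.eval_prod,
        Finset.prod_eq_zero hl (by simp)]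
      simp
  rw [sub_eq_zero] at hdiff
  conv_lhs => rw [hdiff]
  rw [Polynomial.eval_mul, Polynomial.eval_C, hR, Polynomial.eval_prod]
  simp

variable {b : ℕ} {α : ℝ}

lemma overflowFormula_eq_overflowPgf [IsProbabilityMeasure ν] (hb : 1 ≤ b) (hα0 : 0 < α)
    (hα1 : α < 1) (hr : 1 < r) (hC : ∀ j, ν.real {j} * r ^ j ≤ C)
    (hfe : ∀ q : ℂ, ‖q‖ < r → ∫ j, q ^ j ∂ν = Complex.exp (α * b * (q - 1)) * overflowPgf ν b q)
    {q : ℂ} (hq : ‖q‖ < r) (hD : overflowDenom b α q ≠ 0) :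
    overflowFormula b α q = overflowPgf ν b q := by
  have hp : ∀ w : ℂ, ‖w‖ < r →
      (deficitPoly ν b).eval w = overflowDenom b α w * overflowPgf ν b w := fun w hw => by
    rw [eval_deficitPoly hr hC b hw, hfe w hw, overflowDenom]; ring
  -- The generating function is finite at the zeros `ζ_ℓ` of the denominator, since they lie in the
  -- closed unit disc and `r > 1`; so the polynomial vanishes at them.
  obtain ⟨c, hc⟩ := exists_deficitPoly_eq (ν := ν) (zetaRoot_injOn hb hα0 hα1) fun l _ => by
    rw [hp _ ((norm_zetaRoot_le hb hα0 hα1 l).trans_lt hr), overflowDenom,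
      zetaRoot_pow hb hα0 hα1 l, sub_self, zero_mul]
  set R : ℂ → ℂ := fun w => ∏ l ∈ Finset.Ico 1 b, (w - zetaRoot b α l) with hR
  have hc' : ∀ w, (deficitPoly ν b).eval w = c * ((w - 1) * R w) := fun w => by
    rw [hc, Finset.prod_range_eq_mul_Ico _ (by omega), zetaRoot_zero hα0 hα1]
  have hR1 : R 1 ≠ 0 := by
    rw [hR]
    refine Finset.prod_ne_zero_iff.2 fun l hl h => ?_
    have hl' := Finset.mem_Ico.1 hl
    rw [sub_eq_zero, ← zetaRoot_zero (b := b) hα0 hα1] at h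
    have := zetaRoot_injOn hb hα0 hα1 (by simpa using (show 0 < b by omega))
      (by simpa using hl'.2) h
    omega
  have h1r : ‖(1 : ℂ)‖ < r := by simpa using hr
  -- Compare derivatives at `1`: there the denominator `D` has `D(1) = 0` and `D'(1) = b - αb`, and
  -- the generating function is `1`.
  have hder : c * R 1 = b * (1 - α) := by
    have hd1 : HasDerivAt (fun w : ℂ => c * ((w - 1) * R w)) (c * (1 * R 1 + (1 - 1) * deriv R 1)) 1 := by
      have hRd : DifferentiableAt ℂ R 1 := by rw [hR]; fun_prop
      exact (((hasDerivAt_id (1 : ℂ)).sub_const 1).mul hRd.hasDerivAt).const_mul c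
    have hdD : HasDerivAt (overflowDenom b α) (b * 1 ^ (b - 1) -
        Complex.exp (α * b * (1 - 1)) * (α * b * 1)) 1 :=
      (hasDerivAt_pow b (1 : ℂ)).sub
        ((((hasDerivAt_id (1 : ℂ)).sub_const 1).const_mul (α * b : ℂ)).cexp)
    have hd2 := hdD.mul (analyticAt_overflowPgf hr hC b h1r).differentiableAt.hasDerivAt
    have heq : (fun w : ℂ => c * ((w - 1) * R w)) =ᶠ[𝓝 1] overflowDenom b α * overflowPgf ν b := by
      filter_upwards [(continuous_norm.tendsto (1 : ℂ)).eventually_lt_const h1r] with w hw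
      rw [← hc', hp w hw, Pi.mul_apply]
    have h := (hd2.congr_of_eventuallyEq heq).unique hd1
    have hG1 : overflowPgf ν b 1 = 1 := by simp [overflowPgf]
    have hD1 : overflowDenom b α 1 = 0 := by simp [overflowDenom]
    rw [hG1, hD1] at h
    simp only [one_pow, sub_self, mul_zero, Complex.exp_zero, mul_one, one_mul, zero_mul,
      add_zero] at h
    rw [← h]
    ring
  have hcR : c = b * (1 - α) / R 1 := by rw [← hder]; field_simp
  have h3 := (hp q hq).symm.trans (hc' q)
  have h4 : overflowPgf ν b q = c * ((q - 1) * R q) / overflowDenom b α q := by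
    rw [← h3]; field_simp
  rw [h4, hcR]
  simp only [overflowFormula, overflowDenom, hR]
  ring

/-- The formula holds off the zeros of the denominator, which are isolated, and the generating
function supplies the analytic continuation into them. -/
lemma psiQ_eq_overflowPgf [IsProbabilityMeasure ν] (hb : 1 ≤ b) (hα0 : 0 < α)
    (hα1 : α < 1) (hr : 1 < r) (hC : ∀ j, ν.real {j} * r ^ j ≤ C)
    (hfe : ∀ q : ℂ, ‖q‖ < r → ∫ j, q ^ j ∂ν = Complex.exp (α * b * (q - 1)) * overflowPgf ν b q)
    {q : ℂ} (hq : ‖q‖ < r) : psiQ b α q = overflowPgf ν b q := by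
  refine toMeromorphicNFOn_eq_of_analyticAt (meromorphicOn_overflowFormula b α)
    (analyticAt_overflowPgf hr hC b hq) ?_
  filter_upwards [eventually_overflowDenom_ne_zero hb α q, nhdsWithin_le_nhds
    ((continuous_norm.tendsto q).eventually_lt_const hq)] with w hw hwr
  exact overflowFormula_eq_overflowPgf hb hα0 hα1 hr hC hfe hwr hw

lemma psiH_eq_integral_pow [IsProbabilityMeasure ν] (hb : 1 ≤ b) (hα0 : 0 < α)
    (hα1 : α < 1) (hr : 1 < r) (hC : ∀ j, ν.real {j} * r ^ j ≤ C)
    (hfe : ∀ q : ℂ, ‖q‖ < r → ∫ j, q ^ j ∂ν = Complex.exp (α * b * (q - 1)) * overflowPgf ν b q)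
    {q : ℂ} (hq : ‖q‖ < r) : psiH b α q = ∫ j, q ^ j ∂ν := by
  rw [hfe q hq]
  refine toMeromorphicNFOn_eq_of_analyticAt (meromorphicOn_profileFormula b α)
    (g := fun q => Complex.exp (α * b * (q - 1)) * overflowPgf ν b q) ?_ ?_
  · have := analyticAt_overflowPgf hr hC b hq
    fun_prop
  · filter_upwards [eventually_overflowDenom_ne_zero hb α q, nhdsWithin_le_nhds
      ((continuous_norm.tendsto q).eventually_lt_const hq)] with w hw hwr
    rw [profileFormula_eq, overflowFormula_eq_overflowPgf hb hα0 hα1 hr hC hfe hwr hw]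

end GeneratingFunctions

/-! ### The exponential rate and the proof of the theorem -/

/-- The slack `α' > α` absorbs the fluctuation of `n / (b * m)` around `α`. Any `r` between `1` and
`1 / α'` works, since then `(r - 1) α' < 1 - 1 / r ≤ log r`. -/
lemma exists_rate {α : ℝ} (hα0 : 0 < α) (hα1 : α < 1) {b : ℕ} (hb : 1 ≤ b) :
    ∃ r α' ρ : ℝ, 1 < r ∧ α < α' ∧ α' < 1 ∧ Real.exp ((r - 1) * (α' * b)) / r ^ b ≤ ρ ∧ ρ < 1 := by
  obtain ⟨α', h1, h2⟩ := exists_between hα1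
  have hα'0 : 0 < α' := hα0.trans h1
  obtain ⟨r, hr1, hr2⟩ := exists_between (one_lt_one_div hα'0 h2)
  have hr0 : 0 < r := by linarith
  refine ⟨r, α', _, hr1, h1, h2, le_rfl, ?_⟩
  rw [div_lt_one (by positivity), show (r - 1) * (α' * b) = b * ((r - 1) * α') by ring,
    Real.exp_nat_mul]
  refine pow_lt_pow_left₀ ?_ (Real.exp_pos _).le (by omega)
  have h3 := Real.one_sub_inv_le_log_of_pos hr0
  have h4 : α' < r⁻¹ := by rwa [lt_inv_comm₀ hα'0 hr0, ← one_div]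
  have h5 : (r - 1) * α' < 1 - r⁻¹ := by
    calc (r - 1) * α' < (r - 1) * r⁻¹ := by
          have : 0 < r - 1 := by linarith
          gcongr
      _ = 1 - r⁻¹ := by field_simp
  rw [← Real.lt_log_iff_exp_lt hr0]
  linarith

lemma exists_pow_le_mul_pow {s : ℝ} (hs : 1 < s) (l : ℕ) :
    ∃ K : ℝ, ∀ j : ℕ, (j : ℝ) ^ l ≤ K * s ^ j := by
  have h := tendsto_pow_const_div_const_pow_of_one_lt l hs
  obtain ⟨K, hK⟩ := h.bddAbove_range
  refine ⟨K, fun j => ?_⟩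
  have := hK ⟨j, rfl⟩
  rwa [div_le_iff₀ (by positivity)] at this

/-- Pointwise convergence of the laws of `ℕ`-valued random variables with geometric tails implies
convergence in distribution of functions of these random variables. -/
lemma tendstoInDistribution_of_tail {Ω : Type*} [MeasurableSpace Ω] {P : Measure Ω}
    [IsProbabilityMeasure P] {Ω' : ℕ → Type*} [∀ k, MeasurableSpace (Ω' k)]
    {μ : ∀ k, Measure (Ω' k)} [∀ k, IsProbabilityMeasure (μ k)] {Z : ∀ k, Ω' k → ℕ} {Z' : Ω → ℕ}
    (hZ : ∀ k, Measurable (Z k)) (hZ' : AEMeasurable Z' P) {r C : ℝ} (hr : 1 < r)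
    (hC : ∀ᶠ k in atTop, ∀ j, ((μ k).map (Z k)).real {j} * r ^ j ≤ C)
    (hC' : ∀ j, (P.map Z').real {j} * r ^ j ≤ C)
    (hlim : ∀ j, Tendsto (fun k => ((μ k).map (Z k)).real {j}) atTop (𝓝 ((P.map Z').real {j}))) :
    TendstoInDistribution Z atTop Z' μ P := by
  have hpr : ∀ k, IsProbabilityMeasure ((μ k).map (Z k)) := fun k =>
    Measure.isProbabilityMeasure_map (hZ k).aemeasurable
  have hpr' : IsProbabilityMeasure (P.map Z') := Measure.isProbabilityMeasure_map hZ'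
  refine ⟨fun k => (hZ k).aemeasurable, hZ', ?_⟩
  refine ProbabilityMeasure.tendsto_iff_forall_integral_tendsto.2 fun f => ?_
  rw [Metric.tendsto_nhds]
  intro ε hε
  filter_upwards [eventually_norm_integral_sub_le (E := ℝ) zero_le_one hr hC hC' hlim
    (K := ‖f‖) (half_pos hε)] with k hk
  rw [dist_eq_norm]
  refine (hk f fun j => ?_).trans_lt (half_lt_self hε)
  rw [one_pow, mul_one]
  exact f.norm_coe_le_norm j

lemma measureReal_map_singleton {Ω : Type*} [MeasurableSpace Ω] {P : Measure Ω} {Z : Ω → ℕ}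
    (hZ : AEMeasurable Z P) (j : ℕ) : (P.map Z).real {j} = P.real (Z ⁻¹' {j}) := by
  rw [measureReal_def, measureReal_def, Measure.map_apply_of_aemeasurable hZ
    (measurableSet_singleton j)]

theorem mainTheorem2 (b : ℕ) (hb : 1 ≤ b) (α : ℝ) (hα0 : 0 < α) (hα1 : α < 1)
    {Ω : Type*} [MeasurableSpace Ω] (P : Measure Ω) [IsProbabilityMeasure P]
    (X : ℤ → Ω → ℕ) (hXindep : iIndepFun X P)
    (hXlaw : ∀ i, HasLaw (X i) (poissonMeasure (α * b).toNNReal) P)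
    (H Q : ℤ → Ω → ℕ)
    (hH : ∀ i ω, H i ω = profileZ b (fun k => X k ω) i)
    (hQ : ∀ i ω, Q i ω = overflowZ b (fun k => X k ω) i) :
    -- the infinite table is almost surely well defined
    (∀ᵐ ω ∂P, IsMinimalHashing b (fun k => X k ω) (fun k => H k ω) (fun k => Q k ω)) ∧
    MeromorphicOn (profileFormula b α) Set.univ ∧
    MeromorphicOn (overflowFormula b α) Set.univ ∧
    ∃ δ : ℝ, 0 < δ ∧
      -- the generating functions in the infinite Poisson model
      (∀ (i : ℤ) (q : ℂ), ‖q‖ ≤ 1 + δ →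
        Integrable (fun ω => q ^ H i ω) P ∧ pgf P (H i) q = psiH b α q ∧
        Integrable (fun ω => q ^ Q i ω) P ∧ pgf P (Q i) q = psiQ b α q ∧
        pgf P (H i) q = Complex.exp (α * b * (q - 1)) * pgf P (Q i) q) ∧
      (∀ (i : ℤ) (l : ℕ),
        Integrable (fun ω => (H i ω : ℝ) ^ l) P ∧ Integrable (fun ω => (Q i ω : ℝ) ^ l) P) ∧
      -- convergence of the exact model
      ∀ (m n : ℕ → ℕ) [∀ k, NeZero (m k)],
        Tendsto m atTop atTop → Tendsto n atTop atTop →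
        Tendsto (fun k => (n k : ℝ) / (b * m k)) atTop (𝓝 α) →
        ∀ i : ℤ,
          TendstoInDistribution (fun k => profileMN b (m k) (n k) i) atTop (H i)
            (fun k => exactModel (m k) (n k)) P ∧
          TendstoInDistribution (fun k => overflowMN b (m k) (n k) i) atTop (Q i)
            (fun k => exactModel (m k) (n k)) P ∧
          TendstoUniformlyOn
            (fun k q => pgf (exactModel (m k) (n k)) (profileMN b (m k) (n k) i) q)
            (psiH b α) atTop (Metric.closedBall 0 (1 + δ)) ∧
          TendstoUniformlyOn
            (fun k q => pgf (exactModel (m k) (n k)) (overflowMN b (m k) (n k) i) q)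
            (psiQ b α) atTop (Metric.closedBall 0 (1 + δ)) ∧
          ∀ l : ℕ,
            Tendsto (fun k => ∫ h, (profileMN b (m k) (n k) i h : ℝ) ^ l ∂exactModel (m k) (n k))
              atTop (𝓝 (∫ ω, (H i ω : ℝ) ^ l ∂P)) ∧
            Tendsto (fun k => ∫ h, (overflowMN b (m k) (n k) i h : ℝ) ^ l ∂exactModel (m k) (n k))
              atTop (𝓝 (∫ ω, (Q i ω : ℝ) ^ l ∂P)) := by
  obtain ⟨r, α', ρ, hr, hαα', hα'1, hρ0, hρ⟩ := exists_rate hα0 hα1 hb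
  have hb0 : (0 : ℝ) < b := by exact_mod_cast hb
  have ha : 0 ≤ α * b := by positivity
  have hr0 : 0 < r := by linarith
  have hρ0' : Real.exp ((r - 1) * (α * b)) / r ^ b ≤ ρ := by
    refine le_trans ?_ hρ0
    have : 0 ≤ r - 1 := by linarith
    gcongr
  -- The `X i` are only almost everywhere measurable; measurable versions change `H` and `Q` on a
  -- null set only.
  set Y : ℤ → Ω → ℕ := fun k => (hXlaw k).aemeasurable.mk (X k) with hY
  have hXY : ∀ k, X k =ᵐ[P] Y k := fun k => (hXlaw k).aemeasurable.ae_eq_mk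
  have hYm : ∀ k, Measurable (Y k) := fun k => (hXlaw k).aemeasurable.measurable_mk
  have hYi : iIndepFun Y P := hXindep.congr hXY
  have hYl : ∀ k, P.map (Y k) = poissonMeasure (α * b).toNNReal := fun k => by
    rw [← Measure.map_congr (hXY k), (hXlaw k).map_eq]
  have hae : ∀ᵐ ω ∂P, (fun k => X k ω) = fun k => Y k ω := by
    filter_upwards [ae_all_iff.2 hXY] with ω hω
    exact funext hω
  have hHY : ∀ i, H i =ᵐ[P] fun ω => profileZ b (fun k => Y k ω) i := fun i => by
    filter_upwards [hae] with ω hω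
    rw [hH, hω]
  have hbdd := ae_bddAbove_drift hYm hYi hYl ha hr (hρ0'.trans_lt hρ)
  have hmin : ∀ᵐ ω ∂P,
      IsMinimalHashing b (fun k => X k ω) (fun k => H k ω) (fun k => Q k ω) := by
    filter_upwards [hae, hbdd] with ω hω hω2
    have h1 : (fun k => H k ω) = profileZ b (fun k => X k ω) := funext fun k => hH k ω
    have h2 : (fun k => Q k ω) = overflowZ b (fun k => X k ω) := funext fun k => hQ k ω
    rw [h1, h2, hω]
    exact isMinimalHashing_overflowZ hω2
  have hHm : ∀ i, AEMeasurable (H i) P := fun i =>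
    ⟨_, measurable_profileZ hYm b i, hHY i⟩
  have hQH : ∀ i, Q i =ᵐ[P] fun ω => H i ω - b := fun i => by
    filter_upwards [hmin] with ω hω
    exact (hω.1 i).2
  have hQm : ∀ i, AEMeasurable (Q i) P := fun i =>
    ((measurable_from_top (f := fun j : ℕ => j - b)).comp_aemeasurable (hHm i)).congr (hQH i).symm
  -- By stationarity every `H i` has this law, and `Q i = H i - b` almost surely; all statements
  -- about the infinite model become integrals against `ν`.
  set ν : Measure ℕ := P.map fun ω => profileZ b (fun k => Y k ω) 0 with hν
  have hνp : IsProbabilityMeasure ν :=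
    Measure.isProbabilityMeasure_map (measurable_profileZ hYm b 0).aemeasurable
  have hmapH : ∀ i, P.map (H i) = ν := fun i => by
    rw [Measure.map_congr (hHY i), hν]
    exact map_profileZ_eq hYm hYi hYl ha hr (hρ0'.trans_lt hρ) i 0
  have hνC : ∀ j, ν.real {j} * r ^ j ≤ r ^ b / (1 - ρ) := fun j => by
    rw [hν, measureReal_map_singleton (measurable_profileZ hYm b 0).aemeasurable]
    exact profileZ_tail hYm hYi hYl ha hr hρ0' hρ 0 j
  have hintH : ∀ {E : Type} [NormedAddCommGroup E] [NormedSpace ℝ E] (i : ℤ) (f : ℕ → E),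
      ∫ ω, f (H i ω) ∂P = ∫ j, f j ∂ν := fun i f => by
    rw [← hmapH i, integral_map (hHm i) .of_discrete]
  have hintQ : ∀ {E : Type} [NormedAddCommGroup E] [NormedSpace ℝ E] (i : ℤ) (f : ℕ → E),
      ∫ ω, f (Q i ω) ∂P = ∫ j, f (j - b) ∂ν := fun i f => by
    rw [← hintH i fun j => f (j - b)]
    refine integral_congr_ae ?_
    filter_upwards [hQH i] with ω hω
    rw [hω]
  have hinteH : ∀ {E : Type} [NormedAddCommGroup E] (i : ℤ) (f : ℕ → E), Integrable f ν →
      Integrable (fun ω => f (H i ω)) P := fun i f hf => by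
    rw [← hmapH i] at hf
    exact hf.comp_aemeasurable (hHm i)
  have hinteQ : ∀ {E : Type} [NormedAddCommGroup E] (i : ℤ) (f : ℕ → E),
      Integrable (fun j => f (j - b)) ν → Integrable (fun ω => f (Q i ω)) P := fun i f hf => by
    refine (hinteH i _ hf).congr ?_
    filter_upwards [hQH i] with ω hω
    rw [hω]
  have hpgfH : ∀ i q, pgf P (H i) q = ∫ j, q ^ j ∂ν := fun i q => hintH i fun j => q ^ j
  have hpgfQ : ∀ i q, pgf P (Q i) q = overflowPgf ν b q := fun i q => hintQ i fun j => q ^ j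
  have hfe : ∀ q : ℂ, ‖q‖ < r →
      ∫ j, q ^ j ∂ν = Complex.exp (α * b * (q - 1)) * overflowPgf ν b q := fun q _ => by
    -- Independence links `H 0` with the overflow from bucket `-1`; its generating function is that
    -- of every other overflow by stationarity.
    rw [← hpgfH 0, ← hpgfQ (0 - 1)]
    have h1 := pgf_profileZ (b := b) hYm hYi hYl ha 0 q
    have h2 : pgf P (H 0) q = pgf P (fun ω => profileZ b (fun k => Y k ω) 0) q := by
      refine integral_congr_ae ?_
      filter_upwards [hHY 0] with ω hω
      rw [hω]
    have h3 : pgf P (Q (0 - 1)) q = pgf P (fun ω => overflowZ b (fun k => Y k ω) (0 - 1)) q := by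
      refine integral_congr_ae ?_
      filter_upwards [hae] with ω hω
      rw [hQ, hω]
    rw [h2, h3, h1]
    push_cast
    rfl
  -- The radius `1 + δ = s` lies strictly below `r`, so that growth `s ^ j` is summable against the
  -- tails `r ^ (-j)`; `s > 1` also dominates all powers of `j`.
  obtain ⟨s, hs1, hsr⟩ := exists_between hr
  have hs0 : 0 ≤ s := by linarith
  have hδ : 1 + (s - 1) = s := by ring
  refine ⟨hmin, meromorphicOn_profileFormula b α, meromorphicOn_overflowFormula b α, s - 1,
    by linarith, ?_, ?_, ?_⟩
  · intro i q hq
    rw [hδ] at hq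
    have hqr := hq.trans_lt hsr
    have hpsiH := psiH_eq_integral_pow hb hα0 hα1 hr hνC hfe hqr
    have hpsiQ := psiQ_eq_overflowPgf hb hα0 hα1 hr hνC hfe hqr
    refine ⟨hinteH i (fun j => q ^ j) ?_, by rw [hpgfH, hpsiH], hinteQ i (fun j => q ^ j) ?_,
      by rw [hpgfQ, hpsiQ], by rw [hpgfH, hpgfQ, hfe q hqr]⟩
    · exact integrable_of_tail hs0 hsr hνC (norm_pow_sub_le hs1.le hq 0)
    · exact integrable_of_tail hs0 hsr hνC (norm_pow_sub_le hs1.le hq b)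
  · intro i l
    obtain ⟨K, hK⟩ := exists_pow_le_mul_pow hs1 l
    refine ⟨hinteH i (fun j => (j : ℝ) ^ l) (integrable_of_tail (K := K) hs0 hsr hνC fun j => ?_),
      hinteQ i (fun j => (j : ℝ) ^ l) (integrable_of_tail (K := K) hs0 hsr hνC fun j => ?_)⟩
    · rw [Real.norm_of_nonneg (by positivity)]
      exact hK j
    · rw [Real.norm_of_nonneg (by positivity)]
      refine le_trans ?_ (hK j)
      gcongr
      exact Nat.sub_le _ _
  · intro m n hm0 hm hn hmn i
    have hmk : ∀ k, (0 : ℝ) < m k := fun k => by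
      exact_mod_cast Nat.pos_of_ne_zero (NeZero.ne (m k))
    have hmn' : Tendsto (fun k => (n k : ℝ) / m k) atTop (𝓝 (α * b)) := by
      refine (hmn.mul_const (b : ℝ)).congr fun k => ?_
      have := hmk k
      field_simp
    have haa' : α * b < α' * b := by gcongr
    have ha'b : α' * b < b := by nlinarith
    have hev : ∀ᶠ k in atTop, (n k : ℝ) / m k ≤ α' * b ∧ n k < b * m k := by
      filter_upwards [hmn'.eventually_lt_const haa'] with k hk
      refine ⟨hk.le, ?_⟩
      have : (n k : ℝ) < b * m k := by
        rw [← div_lt_iff₀ (hmk k)]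
        exact hk.trans ha'b
      exact_mod_cast this
    have hZm : ∀ k, Measurable (profileMN b (m k) (n k) i) := fun k => measurable_of_finite _
    set νk : ℕ → Measure ℕ := fun k => (exactModel (m k) (n k)).map (profileMN b (m k) (n k) i)
      with hνk
    have hνkp : ∀ k, IsProbabilityMeasure (νk k) := fun k =>
      Measure.isProbabilityMeasure_map (hZm k).aemeasurable
    have hCk : ∀ᶠ k in atTop, ∀ j, (νk k).real {j} * r ^ j ≤ r ^ b / (1 - ρ) := by
      filter_upwards [hev] with k hk j
      rw [hνk, measureReal_map_singleton (hZm k).aemeasurable]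
      exact profileMN_tail hk.2 hr.le hk.1 hρ0 hρ i j
    have hlim : ∀ j, Tendsto (fun k => (νk k).real {j}) atTop (𝓝 (ν.real {j})) := fun j => by
      have h := tendsto_measureReal_profileMN hYm hYi hYl ha hr haa' ha'b hρ0 hρ hm hn hmn' i j
      rw [← measureReal_map_singleton (measurable_profileZ hYm b i).aemeasurable,
        map_profileZ_eq hYm hYi hYl ha hr (hρ0'.trans_lt hρ) i 0, ← hν] at h
      refine h.congr fun k => ?_
      rw [hνk, measureReal_map_singleton (hZm k).aemeasurable]
    have hintk : ∀ {E : Type} [NormedAddCommGroup E] [NormedSpace ℝ E] (k : ℕ) (f : ℕ → E),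
        ∫ h, f (profileMN b (m k) (n k) i h) ∂exactModel (m k) (n k) = ∫ j, f j ∂νk k :=
      fun k f => (integral_map (hZm k).aemeasurable .of_discrete).symm
    have hQk : ∀ᶠ k in atTop, ∀ h, overflowMN b (m k) (n k) i h = profileMN b (m k) (n k) i h - b := by
      filter_upwards [hev] with k hk h
      exact (hashingEquations_finalTable h hk.2.le i).2
    have hdistH : TendstoInDistribution (fun k => profileMN b (m k) (n k) i) atTop (H i)
        (fun k => exactModel (m k) (n k)) P := by
      refine tendstoInDistribution_of_tail hZm (hHm i) hr hCk ?_ ?_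
      · rw [hmapH i]; exact hνC
      · rw [hmapH i]; exact hlim
    have key : ∀ {E : Type} [NormedAddCommGroup E] [NormedSpace ℝ E] [CompleteSpace E] (K : ℝ)
        {ε : ℝ}, 0 < ε → ∀ᶠ k in atTop, ∀ f : ℕ → E, (∀ j, ‖f j‖ ≤ K * s ^ j) →
        ‖∫ j, f j ∂νk k - ∫ j, f j ∂ν‖ ≤ ε := by
      intro E _ _ _ K ε hε
      exact eventually_norm_integral_sub_le hs0 hsr hCk hνC hlim hε
    refine ⟨hdistH, ?_, ?_, ?_, fun l => ?_⟩
    -- The overflow is a continuous image of the profile, but in the exact model only once `n < b *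
    -- m`, so the sequences of laws agree only eventually.
    · have h1 := hdistH.continuous_comp (continuous_of_discreteTopology (f := fun j : ℕ => j - b))
      refine ⟨fun k => (measurable_of_finite _).aemeasurable, hQm i, ?_⟩
      have h2 := h1.tendsto
      have h3 : (⟨P.map (Q i), Measure.isProbabilityMeasure_map (hQm i)⟩ : ProbabilityMeasure ℕ) =
          ⟨P.map ((fun j : ℕ => j - b) ∘ H i),
            Measure.isProbabilityMeasure_map h1.aemeasurable_limit⟩ :=
        Subtype.ext (Measure.map_congr (hQH i))
      rw [h3]
      refine h2.congr' ?_
      filter_upwards [hQk] with k hk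
      refine Subtype.ext ?_
      have : overflowMN b (m k) (n k) i = (fun j : ℕ => j - b) ∘ profileMN b (m k) (n k) i :=
        funext hk
      simp only [this]
    · rw [Metric.tendstoUniformlyOn_iff]
      intro ε hε
      filter_upwards [key (E := ℂ) 1 (half_pos hε)] with k hk q hq
      rw [hδ] at hq
      have hq' : ‖q‖ ≤ s := by simpa using hq
      rw [psiH_eq_integral_pow hb hα0 hα1 hr hνC hfe (hq'.trans_lt hsr), dist_comm, dist_eq_norm]
      refine lt_of_le_of_lt ?_ (half_lt_self hε)
      unfold pgf
      rw [hintk k fun j => q ^ j]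
      exact hk _ (norm_pow_sub_le hs1.le hq' 0)
    · rw [Metric.tendstoUniformlyOn_iff]
      intro ε hε
      filter_upwards [key (E := ℂ) 1 (half_pos hε), hQk] with k hk hk2 q hq
      rw [hδ] at hq
      have hq' : ‖q‖ ≤ s := by simpa using hq
      rw [psiQ_eq_overflowPgf hb hα0 hα1 hr hνC hfe (hq'.trans_lt hsr), dist_comm, dist_eq_norm]
      refine lt_of_le_of_lt ?_ (half_lt_self hε)
      unfold pgf
      simp only [hk2]
      rw [hintk k fun j => q ^ (j - b)]
      exact hk _ (norm_pow_sub_le hs1.le hq' b)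
    · obtain ⟨K, hK⟩ := exists_pow_le_mul_pow hs1 l
      have hf1 : ∀ j : ℕ, ‖(j : ℝ) ^ l‖ ≤ K * s ^ j := fun j => by
        rw [Real.norm_of_nonneg (by positivity)]
        exact hK j
      have hf2 : ∀ j : ℕ, ‖((j - b : ℕ) : ℝ) ^ l‖ ≤ K * s ^ j := fun j => by
        rw [Real.norm_of_nonneg (by positivity)]
        refine le_trans ?_ (hK j)
        gcongr
        exact Nat.sub_le _ _
      constructor
      · rw [Metric.tendsto_nhds]
        intro ε hε
        filter_upwards [key (E := ℝ) K (half_pos hε)] with k hk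
        rw [hintk k fun j => (j : ℝ) ^ l, hintH i fun j => (j : ℝ) ^ l, dist_eq_norm]
        exact (hk _ hf1).trans_lt (half_lt_self hε)
      · rw [Metric.tendsto_nhds]
        intro ε hε
        filter_upwards [key (E := ℝ) K (half_pos hε), hQk] with k hk hk2
        simp only [hk2]
        rw [hintk k fun j => ((j - b : ℕ) : ℝ) ^ l, hintQ i fun j => (j : ℝ) ^ l, dist_eq_norm]
        exact (hk _ hf2).trans_lt (half_lt_self hε)
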